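/- **Conventions.** Let $\Sigma=\{0,1\}$. A *binary function* is a possibly partial function $\sigma:\Sigma^*\times\Sigma^*\to\Sigma^*$. FP is the class of partial functions computable by deterministic polynomial-time Turing machines: such a machine halts on every input within polynomial time, outputs the value where the function is defined, and rejects where it is undefined. P is the class of languages over $\Sigma$ decided by deterministic polynomial-time Turing machines. UP is the class of languages over $\Sigma$ accepted by nondeterministic polynomial-time Turing machines that have at most one accepting computation path on every input. **Definitions.** Let $\sigma$ be a binary function. * $\sigma$ is *honest* if there is a polynomial $p$ such that every $z\in\mathrm{range}(\sigma)$ has some $(x,y)\in\mathrm{domain}(\sigma)$ with $\sigma(x,y)=z$ and $|x|+|y|\le p(|z|)$. * $\sigma$ is *FP-invertible* if there is a total $g\in\mathrm{FP}$ such that for every $z\in\mathrm{range}(\sigma)$, $g(z)$ is a pair in $\mathrm{domain}(\sigma)$ that $\sigma$ maps to $z$. * $\sigma$ is *one-way* if it is honest, in FP, and not FP-invertible. * $\sigma$ is *weakly associative* if $\sigma(x,\sigma(y,z))=\sigma(\sigma(x,y),z)$ for all $x,y,z\in\Sigma^*$ for which $(x,y)$, $(y,z)$, $(x,\sigma(y,z))$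 and $(\sigma(x,y),z)$ all lie in $\mathrm{domain}(\sigma)$. * $\sigma$ is *associative* if for all $x,y,z\in\Sigma^*$ the expressions $\sigma(x,\sigma(y,z))$ and $\sigma(\sigma(x,y),z)$ are either both undefined, or both defined and equal (an expression with an undefined subexpression is undefined). $\sigma$ is *commutative* if for all $x,y\in\Sigma^*$, $\sigma(x,y)$ and $\sigma(y,x)$ are either both undefined, or both defined and equal. * An *AOWF* is an associative one-way binary function; an *A$^{w}$OWF* is a weakly associative one-way binary function. * $\sigma$ is *strong* if neither of the following holds: (a) there is a total $g_1\in\mathrm{FP}$ such that for all $x,z$, if $\sigma(x,y)=z$ for some $y$, then $\sigma(x,g_1(x,z))=z$; (b) there is a total $g_2\in\mathrm{FP}$ such that for all $y,z$, if $\sigma(x,y)=z$ for some $x$, then $\sigma(g_2(y,z),y)=z$. * $\sigma$ is *injective* if for all $(a,b),(c,d)\in\mathrm{domain}(\sigma)$, $\sigma(a,b)=\sigma(c,d)$ implies $(a,b)=(c,d)$; it is *unordered-injective* if $\sigma(a,b)=\sigma(c,d)$ implies $\{a,b\}=\{c,d\}$ for all such pairs. **Theorem.** The following are equivalent. 1.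 $\mathrm{P}\neq\mathrm{UP}$. 2. There exist injective A$^{w}$OWFs. 3. There exist injective AOWFs. 4. There exist strong, commutative, unordered-injective A$^{w}$OWFs. 5. There exist strong, commutative, unordered-injective AOWFs. -/

import Mathlib

namespace OneWay

/-! ### Machines, polynomial time, and the classes P and UP -/

/-- Strings over the alphabet `{0, 1}`. -/
abbrev Str : Type := List Bool

/-- A deterministic Turing machine in the multi-stack model `Turing.TM2` of Mathlib, with `m`
input strings and `n` output strings.  All data are finite: finitely many stacks `K` of bits (with
detectable bottom), finitely many labels `Λ`, a finite internal memory `σ`.  A work tape is a pair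
of stacks.  A halted computation accepts or rejects, according to the internal memory. -/
structure TM (m n : ℕ) where
  K : Type
  [decK : DecidableEq K]
  [finK : Fintype K]
  /-- the input stacks, one for each argument -/
  inp : Fin m ↪ K
  /-- the output stacks -/
  out : Fin n → K
  Λ : Type
  [finΛ : Fintype Λ]
  /-- the label at which the computation starts -/
  main : Λ
  σ : Type
  [finσ : Fintype σ]
  /-- the initial content of the internal memory -/
  start : σ
  /-- which contents of the internal memory are accepting -/
  acc : σ → Bool
  /-- the program: at each label, the statement that is executed in one step -/
  prog : Λ → Turing.TM2.Stmt (fun _ : K => Bool) Λ σ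

attribute [instance] TM.decK TM.finK TM.finΛ TM.finσ

namespace TM

variable {m n : ℕ}

/-- Configurations: current label (`none` once the machine has halted), memory, stacks. -/
abbrev Cfg (M : TM m n) : Type := Turing.TM2.Cfg (fun _ : M.K => Bool) M.Λ M.σ

/-- One step of the computation; `none` on halted configurations. -/
def step (M : TM m n) : M.Cfg → Option M.Cfg := Turing.TM2.step M.prog

/-- The initial configuration: the inputs on the input stacks (first letter on top), all other
stacks empty. -/
noncomputable def init (M : TM m n) (x : Fin m → Str) : M.Cfg :=
  ⟨some M.main, M.start, Function.extend M.inp x (fun _ => [])⟩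

/-- A configuration is accepting if the machine has halted and its memory is accepting. -/
def Accepting (M : TM m n) (c : M.Cfg) : Prop := c.l = none ∧ M.acc c.var = true

/-- On input `x`, the machine halts after at most `t` steps, in configuration `c`. -/
def HaltsWithin (M : TM m n) (x : Fin m → Str) (t : ℕ) (c : M.Cfg) : Prop :=
  Nonempty (StateTransition.EvalsToInTime M.step (M.init x) (some c) t) ∧ c.l = none

/-- The result of a halted computation: the content of the output stacks if the machine accepts;
a rejecting computation produces no output. -/
def result (M : TM m n) (c : M.Cfg) : Option (Fin n → Str) :=
  if M.acc c.var = true then some (fun j => c.stk (M.out j)) else none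

end TM

/-- The total length of a tuple of strings. -/
def size {m : ℕ} (x : Fin m → Str) : ℕ := ∑ i, (x i).length

/-- FP: the polynomial-time computable partial functions, from `m`-tuples of strings to
`n`-tuples of strings.  Some machine halts on every input within polynomial time, with the value
of the function as output where the function is defined, and rejecting where it is undefined. -/
def FP (m n : ℕ) : Set ((Fin m → Str) → Option (Fin n → Str)) :=
  {F | ∃ (M : TM m n) (p : Polynomial ℕ), ∀ x : Fin m → Str,
    ∃ c, M.HaltsWithin x (p.eval (size x)) c ∧ M.result c = F x}

/-- P: the languages decided by a deterministic polynomial-time machine. -/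
def P : Set (Language Bool) :=
  {L | ∃ (M : TM 1 0) (p : Polynomial ℕ), ∀ x : Str,
    ∃ c, M.HaltsWithin ![x] (p.eval x.length) c ∧ (M.Accepting c ↔ x ∈ L)}

/-- A nondeterministic Turing machine (language acceptor): at each label there is either one
statement `prog` that can be executed, or a binary choice between the two statements `prog` and
`alt`. -/
structure NTM extends TM 1 0 where
  alt : Λ → Option (Turing.TM2.Stmt (fun _ : K => Bool) Λ σ)

namespace NTM

/-- One step of the computation; the bit is the nondeterministic choice. The value is `none` if
there is no such step. -/
def stepWith (N : NTM) (b : Bool) (c : N.toTM.Cfg) : Option N.toTM.Cfg :=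
  match c.l, b with
  | none, _ => none
  | some l, false => some (Turing.TM2.stepAux (N.prog l) c.var c.stk)
  | some l, true => (N.alt l).map fun q => Turing.TM2.stepAux q c.var c.stk

/-- The configuration that is reached by following a sequence of choices, if these steps exist. -/
def follow (N : NTM) : List Bool → N.toTM.Cfg → Option N.toTM.Cfg
  | [], c => some c
  | b :: w, c => (N.stepWith b c).bind (N.follow w)

/-- `w` is an (initial segment of a) computation path of the machine on input `x`; computation
paths are given by the sequence of their steps. -/
def IsPath (N : NTM) (x : Str) (w : List Bool) : Prop :=
  ∃ c, N.follow w (N.toTM.init ![x]) = some c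

/-- `w` is an accepting computation path of the machine on input `x`. -/
def IsAcceptingPath (N : NTM) (x : Str) (w : List Bool) : Prop :=
  ∃ c, N.follow w (N.toTM.init ![x]) = some c ∧ N.toTM.Accepting c

end NTM

/-- UP: the languages accepted by a nondeterministic polynomial-time machine that has at most one
accepting path on every input. -/
def UP : Set (Language Bool) :=
  {L | ∃ (N : NTM) (p : Polynomial ℕ),
    (∀ x w, N.IsPath x w → w.length ≤ p.eval x.length) ∧
    (∀ x w w', N.IsAcceptingPath x w → N.IsAcceptingPath x w' → w = w') ∧
    ∀ x, x ∈ L ↔ ∃ w, N.IsAcceptingPath x w}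

/-! ### Binary functions

A (partial) binary function is `f : Str → Str → Option Str`, where `f x y = none` means that
`(x, y)` is not in the domain. -/

/-- Honesty: every element of the range has a preimage of polynomially bounded length. -/
def Honest (f : Str → Str → Option Str) : Prop :=
  ∃ p : Polynomial ℕ, ∀ z, (∃ x y, f x y = some z) →
    ∃ x y, f x y = some z ∧ x.length + y.length ≤ p.eval z.length

/-- `f` is polynomial-time computable. -/
def PolyTimeComputable (f : Str → Str → Option Str) : Prop :=
  (fun v : Fin 2 → Str => (f (v 0) (v 1)).map fun z => ![z]) ∈ FP 2 1

/-- Some total polynomial-time computable function finds a preimage of every element of the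
range. -/
def FPInvertible (f : Str → Str → Option Str) : Prop :=
  ∃ g : Str → Str × Str,
    (fun v : Fin 1 → Str => some ![(g (v 0)).1, (g (v 0)).2]) ∈ FP 1 2 ∧
    ∀ z, (∃ x y, f x y = some z) → f (g z).1 (g z).2 = some z

/-- One-way functions, in the worst-case sense. -/
def IsOneWay (f : Str → Str → Option Str) : Prop :=
  Honest f ∧ PolyTimeComputable f ∧ ¬ FPInvertible f

/-- `x ∘ (y ∘ z) = (x ∘ y) ∘ z` whenever all four applications of `∘` are defined. -/
def WeaklyAssociative (f : Str → Str → Option Str) : Prop :=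
  ∀ x y z xy yz a b, f x y = some xy → f y z = some yz →
    f x yz = some a → f xy z = some b → a = b

/-- The extension of `f` to strings and `⊥` (here `none`); it is `⊥` where `f` is undefined and
where an argument is `⊥`. -/
def extension (f : Str → Str → Option Str) : Option Str → Option Str → Option Str
  | some a, some b => f a b
  | _, _ => none

/-- Associativity with complete equality: the two sides are both undefined, or both defined and
equal. -/
def Associative (f : Str → Str → Option Str) : Prop :=
  ∀ x y z : Str, extension f (extension f (some x) (some y)) (some z) =
    extension f (some x) (extension f (some y) (some z))

/-- Commutativity with complete equality. -/
def Commutative (f : Str → Str → Option Str) : Prop :=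
  ∀ x y : Str, extension f (some x) (some y) = extension f (some y) (some x)

/-- Associative one-way functions. -/
def IsAOWF (f : Str → Str → Option Str) : Prop := Associative f ∧ IsOneWay f

/-- Weakly associative one-way functions. -/
def IsAwOWF (f : Str → Str → Option Str) : Prop := WeaklyAssociative f ∧ IsOneWay f

/-- `f` cannot be inverted in polynomial time even if the first argument is given, nor if the
second argument is given. -/
def Strong (f : Str → Str → Option Str) : Prop :=
  (¬ ∃ g : Str → Str → Str,
    (fun v : Fin 2 → Str => some ![g (v 0) (v 1)]) ∈ FP 2 1 ∧
    ∀ z x, (∃ y, f x y = some z) → f x (g x z) = some z) ∧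
  (¬ ∃ g : Str → Str → Str,
    (fun v : Fin 2 → Str => some ![g (v 0) (v 1)]) ∈ FP 2 1 ∧
    ∀ z y, (∃ x, f x y = some z) → f (g y z) y = some z)

/-- Injectivity on the domain. -/
def Injective (f : Str → Str → Option Str) : Prop :=
  ∀ a b c d z, f a b = some z → f c d = some z → (a, b) = (c, d)

/-- Every element of the range has only one unordered pair as its preimage. -/
def UnorderedInjective (f : Str → Str → Option Str) : Prop :=
  ∀ a b c d z, f a b = some z → f c d = some z → ({a, b} : Set Str) = {c, d}

end OneWay

/-! If `P ≠ UP`, then, since `P ⊆ UP`, there is a language in `UP` outside `P`. The accepting paths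
of a machine for it are unique witnesses: there is a polynomial-time relation `V`, with witnesses of
polynomial length, such that `V x w` holds for at most one `w`, and for some `w` exactly if `x ∈ L`
(`exists_witness_of_mem_UP`). The function `(10x, 11w) ↦ 0x`, defined where `V x w` holds, is honest
and injective, and inverting it means finding witnesses, which would put `L` into `P`. Its arguments
begin with `1` and its values with `0`, so a value is never an argument, all iterated products are
undefined, and associativity holds in the strict sense (`associative_of_range`). Admitting both
orders of the arguments makes the function commutative and unordered-injective. It is then also
strong: knowing `10x` and `0x` is no more than knowing `x`, and the missing argument contains the
witness (`strong_unorderedFn`).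

Conversely, if `P = UP`, every honest polynomial-time function `f` that is unordered-injective can
be inverted (`fpInvertible_of_P_eq_UP`). Each `z` in the range has only one unordered pair as a
preimage; a lexicographic tie-break selects one ordering, and padding fixes the length of its
encoding, which is thus a unique witness. Hence the set of all `(i, z)` for which the `i`-th letter
of this encoding is `1` lies in `UP = P`, and the preimage is recovered letter by letter. Injective
functions are unordered-injective, and associativity implies weak associativity, so these two
implications close all cycles.

Most of the work is to justify "polynomial time" for the machine model. Program fragments are
combined into sequences, case distinctions and loops, with control of time and space. This gives a
calculus `PF` of polynomial-time functions, closed under composition and under folds of polynomially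
bounded size. `FP.exists_pf`, `FP.of_pf` and `mem_P_iff` translate between this calculus and
machines; `NTM.exists_pf_isAcceptingPath` and `mem_UP_of_unique` do so for nondeterministic machines
and unique witnesses. -/

namespace OneWay

open Turing Function

/-! ### Step counting -/

/-- `StepsTo f n a b`: iterating the partial function `f` exactly `n` times leads from `a` to `b`. -/
inductive StepsTo {C : Type*} (f : C → Option C) : ℕ → C → C → Prop
  | refl (a : C) : StepsTo f 0 a a
  | head {n : ℕ} {a b c : C} : f a = some b → StepsTo f n b c → StepsTo f (n + 1) a c

namespace StepsTo

variable {C : Type*} {f : C → Option C}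

theorem single {a b : C} (h : f a = some b) : StepsTo f 1 a b := .head h (.refl b)

theorem trans {m n : ℕ} {a b c : C} (h₁ : StepsTo f m a b) (h₂ : StepsTo f n b c) :
    StepsTo f (m + n) a c := by
  induction h₁ with
  | refl a => simpa using h₂
  | @head k a b' c' h _ ih =>
    rw [show k + 1 + n = (k + n) + 1 by omega]
    exact .head h (ih h₂)

/-- Undefinedness is absorbing for `flip bind f`, so an iteration that ends in `some b` has passed
through defined values only. -/
theorem iff_iterate {n : ℕ} {a b : C} :
    StepsTo f n a b ↔ (flip bind f)^[n] (some a) = some b := by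
  induction n generalizing a with
  | zero =>
    constructor
    · rintro ⟨⟩; rfl
    · intro h
      obtain rfl : a = b := by simpa using h
      exact .refl a
  | succ n ih =>
    rw [Function.iterate_succ_apply]
    have key : flip bind f (some a) = f a := rfl
    rw [key]
    constructor
    · rintro ⟨⟩
      rename_i c h h'
      rw [h]; exact ih.1 h'
    · intro h
      cases hfa : f a with
      | none =>
        rw [hfa] at h
        have : ∀ k, (flip bind f)^[k] (none : Option C) = none := by
          intro k; induction k with
          | zero => rfl
          | succ k ihk => rw [Function.iterate_succ_apply]; exact ihk
        rw [this] at h; cases h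
      | some c =>
        rw [hfa] at h
        exact .head hfa (ih.2 h)

theorem nonempty_evalsToInTime_iff {t : ℕ} {a b : C} :
    Nonempty (StateTransition.EvalsToInTime f a (some b) t) ↔ ∃ n ≤ t, StepsTo f n a b := by
  constructor
  · rintro ⟨⟨⟨n, h⟩, hn⟩⟩
    exact ⟨n, hn, iff_iterate.2 h⟩
  · rintro ⟨n, hn, h⟩
    exact ⟨⟨⟨n, iff_iterate.1 h⟩, hn⟩⟩

end StepsTo

/-! ### Embedding statements into larger machines -/

/-- Statements acting on stacks of bits. -/
abbrev BStmt (K Λ σ : Type) : Type := TM2.Stmt (fun _ : K => Bool) Λ σ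

/-- Configurations with stacks of bits. -/
abbrev BCfg (K Λ σ : Type) : Type := TM2.Cfg (fun _ : K => Bool) Λ σ

/-- The data for embedding a machine into a larger one: stacks, labels, and a part of the memory. -/
structure Emb (K Λ σ K' Λ' σ' : Type) where
  stk : K ↪ K'
  lab : Λ → Λ'
  get : σ' → σ
  set : σ → σ' → σ'
  get_set : ∀ s v, get (set s v) = s
  set_set : ∀ s₁ s₂ v, set s₂ (set s₁ v) = set s₂ v
  set_get : ∀ v, set (get v) v = v

namespace Emb

variable {K Λ σ K' Λ' σ' : Type} [DecidableEq K']

attribute [simp] get_set set_set set_get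

/-- The image of a statement; halting is replaced by the statement `h`. -/
def stmt (E : Emb K Λ σ K' Λ' σ') (h : BStmt K' Λ' σ') : BStmt K Λ σ → BStmt K' Λ' σ'
  | .push k f q => .push (E.stk k) (fun v => f (E.get v)) (E.stmt h q)
  | .peek k f q => .peek (E.stk k) (fun v o => E.set (f (E.get v) o) v) (E.stmt h q)
  | .pop k f q => .pop (E.stk k) (fun v o => E.set (f (E.get v) o) v) (E.stmt h q)
  | .load f q => .load (fun v => E.set (f (E.get v)) v) (E.stmt h q)
  | .branch p q₁ q₂ => .branch (fun v => p (E.get v)) (E.stmt h q₁) (E.stmt h q₂)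
  | .goto l => .goto (fun v => E.lab (l (E.get v)))
  | .halt => h

/-- The image of a configuration; where it has halted, `h` is executed. -/
noncomputable def cfg (E : Emb K Λ σ K' Λ' σ') (h : BStmt K' Λ' σ') (v : σ') (S : K' → Str)
    (c : BCfg K Λ σ) : BCfg K' Λ' σ' :=
  match c.l with
  | some l => ⟨some (E.lab l), E.set c.var v, extend E.stk c.stk S⟩
  | none => TM2.stepAux h (E.set c.var v) (extend E.stk c.stk S)

theorem extend_comp_self {α β γ : Type*} (e : α ↪ β) (S : β → γ) :
    extend e (S ∘ e) S = S := by
  funext k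
  by_cases hk : ∃ a, e a = k
  · obtain ⟨a, rfl⟩ := hk
    exact e.injective.extend_apply _ _ _
  · exact extend_apply' _ _ _ hk

theorem extend_congr_off {α β γ : Type*} (e : α ↪ β) (T : α → γ) {S S' : β → γ}
    (h : ∀ k, k ∉ Set.range e → S k = S' k) : extend e T S = extend e T S' := by
  funext k
  by_cases hk : ∃ a, e a = k
  · obtain ⟨a, rfl⟩ := hk
    rw [e.injective.extend_apply, e.injective.extend_apply]
  · rw [extend_apply' _ _ _ hk, extend_apply' _ _ _ hk]
    exact h k (by simpa using hk)

theorem eq_extend {α β γ : Type*} (e : α ↪ β) {T : α → γ} {S S' : β → γ}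
    (h : S' ∘ e = T) (h' : ∀ k, k ∉ Set.range e → S' k = S k) : extend e T S = S' := by
  rw [← h, ← extend_congr_off e _ h', extend_comp_self]

/-- The simulated configuration overwrites its own part of the memory and its own stacks, so only
what lies outside of them matters. -/
theorem cfg_congr (E : Emb K Λ σ K' Λ' σ') (h : BStmt K' Λ' σ') {v v' : σ'} {S S' : K' → Str}
    (hv : ∀ s, E.set s v = E.set s v') (hS : ∀ k, k ∉ Set.range E.stk → S k = S' k)
    (c : BCfg K Λ σ) : E.cfg h v S c = E.cfg h v' S' c := by
  simp only [cfg, extend_congr_off E.stk _ hS, hv]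

variable [DecidableEq K]

/-- Where the original statement halts, `h` is executed within the same step; the simulation
therefore costs no additional time. -/
theorem stepAux_stmt (E : Emb K Λ σ K' Λ' σ') (h : BStmt K' Λ' σ') (q : BStmt K Λ σ) (v : σ')
    (S : K' → Str) :
    TM2.stepAux (E.stmt h q) v S =
      E.cfg h v S (TM2.stepAux q (E.get v) (S ∘ E.stk)) := by
  induction q generalizing v S with
  | push k f q ih =>
    rw [stmt, TM2.stepAux, ih, TM2.stepAux, update_comp_eq_of_injective _ E.stk.injective]
    apply cfg_congr _ _ (fun _ => rfl)
    intro k' hk'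
    exact update_of_ne (fun e => hk' ⟨k, e.symm⟩) _ _
  | peek k f q ih =>
    rw [stmt, TM2.stepAux, ih, TM2.stepAux, get_set]
    exact cfg_congr _ _ (fun _ => by simp) (fun _ _ => rfl) _
  | pop k f q ih =>
    rw [stmt, TM2.stepAux, ih, TM2.stepAux, get_set,
      update_comp_eq_of_injective _ E.stk.injective]
    apply cfg_congr _ _ (fun _ => by simp)
    intro k' hk'
    exact update_of_ne (fun e => hk' ⟨k, e.symm⟩) _ _
  | load f q ih =>
    rw [stmt, TM2.stepAux, ih, TM2.stepAux, get_set]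
    exact cfg_congr _ _ (fun _ => by simp) (fun _ _ => rfl) _
  | branch p q₁ q₂ ih₁ ih₂ =>
    rw [stmt, TM2.stepAux, ih₁, ih₂, TM2.stepAux]
    cases p (E.get v) <;> rfl
  | goto l =>
    simp [stmt, cfg, extend_comp_self]
  | halt =>
    simp [stmt, cfg, extend_comp_self]

/-- A halting computation is simulated by an embedded copy of the machine. -/
theorem stepsTo (E : Emb K Λ σ K' Λ' σ') (h : BStmt K' Λ' σ') {prog : Λ → BStmt K Λ σ}
    {prog' : Λ' → BStmt K' Λ' σ'} (hprog : ∀ l, prog' (E.lab l) = E.stmt h (prog l)) {n : ℕ}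
    {l : Λ} {v : σ} {S : K → Str} {c : BCfg K Λ σ}
    (hsteps : StepsTo (TM2.step prog) n ⟨some l, v, S⟩ c) (hc : c.l = none)
    {v' : σ'} {S' : K' → Str} (hv : E.get v' = v) (hS : S' ∘ E.stk = S) :
    StepsTo (TM2.step prog') n ⟨some (E.lab l), v', S'⟩ (E.cfg h v' S' c) := by
  induction n generalizing l v S v' S' with
  | zero => cases hsteps; cases hc
  | succ n ih =>
    rcases hsteps with _ | ⟨hb, hrest⟩
    simp only [TM2.step, Option.some.injEq] at hb
    subst hv hS
    refine .head (b := E.cfg h v' S' (TM2.stepAux (prog l) (E.get v') (S' ∘ E.stk))) ?_ ?_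
    · rw [TM2.step, hprog, stepAux_stmt]
    · rw [hb]
      rename_i b
      obtain ⟨lb, vb, Sb⟩ := b
      cases lb with
      | none =>
        cases hrest with
        | refl => exact .refl _
        | head h1 _ => simp [TM2.step] at h1
      | some l' =>
        have := ih hrest (v' := E.set vb v') (S' := extend E.stk Sb S') (by simp)
          (by funext k; exact E.stk.injective.extend_apply _ _ _)
        rw [cfg_congr E h (v := v') (v' := E.set vb v') (S' := extend E.stk Sb S') (by simp)
          (fun k hk => (extend_apply' _ _ _ (by simpa using hk)).symm) c]
        exact this

end Emb

/-! ### Sizes of stack contents -/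

/-- The total length of the strings on a family of stacks. -/
def total {K : Type} [Fintype K] (S : K → Str) : ℕ := ∑ k, (S k).length

section total

variable {K : Type} [Fintype K]

theorem length_le_total (S : K → Str) (k : K) : (S k).length ≤ total S :=
  Finset.single_le_sum (f := fun k => (S k).length) (fun _ _ => Nat.zero_le _) (Finset.mem_univ k)

theorem total_comp_le {K' : Type} [Fintype K'] (S : K → Str) {e : K' → K}
    (he : Function.Injective e) : total (fun k => S (e k)) ≤ total S := by
  have h := Finset.sum_map Finset.univ ⟨e, he⟩ fun k => (S k).length
  exact h.symm.trans_le (Finset.sum_le_sum_of_subset (Finset.subset_univ _))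

theorem total_update [DecidableEq K] (S : K → Str) (k : K) (x : Str) :
    total (update S k x) + (S k).length = total S + x.length := by
  have h : ∀ T : K → Str, total T = (T k).length + ∑ j ∈ Finset.univ.erase k, (T j).length :=
    fun T => (Finset.add_sum_erase _ _ (Finset.mem_univ k)).symm
  have h2 : ∑ j ∈ Finset.univ.erase k, (update S k x j).length
      = ∑ j ∈ Finset.univ.erase k, (S j).length :=
    Finset.sum_congr rfl fun j hj => by rw [update_of_ne (Finset.ne_of_mem_erase hj)]
  rw [h (update S k x), h S, h2, update_self]
  omega

/-- The number of push instructions of a statement. -/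
def pushes {Λ σ : Type} : BStmt K Λ σ → ℕ
  | .push _ _ q => pushes q + 1
  | .peek _ _ q => pushes q
  | .pop _ _ q => pushes q
  | .load _ q => pushes q
  | .branch _ q₁ q₂ => pushes q₁ + pushes q₂
  | .goto _ => 0
  | .halt => 0

theorem total_stepAux_le [DecidableEq K] {Λ σ : Type} (q : BStmt K Λ σ) (v : σ) (S : K → Str) :
    total (TM2.stepAux q v S).stk ≤ total S + pushes q := by
  induction q generalizing v S with
  | push k f q ih =>
    refine (ih _ _).trans ?_
    have := total_update S k (f v :: S k)
    simp only [List.length_cons] at this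
    simp only [pushes]
    omega
  | peek k f q ih => exact ih _ _
  | pop k f q ih =>
    refine (ih _ _).trans ?_
    have := total_update S k (S k).tail
    simp only [List.length_tail] at this
    simp only [pushes]
    omega
  | load f q ih => exact ih _ _
  | branch p q₁ q₂ ih₁ ih₂ =>
    rw [TM2.stepAux]
    simp only [pushes]
    cases p v
    · exact (ih₂ _ _).trans (by omega)
    · exact (ih₁ _ _).trans (by omega)
  | goto l => simp [pushes]
  | halt => simp [pushes]

/-- One step adds at most as many letters as its statement has push instructions, and there are
finitely many statements. So space is linear in time, which is what bounds the input of a subsequent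
program. -/
theorem exists_total_le [DecidableEq K] {Λ σ : Type} [Fintype Λ] (prog : Λ → BStmt K Λ σ) :
    ∃ C, ∀ n a b, StepsTo (TM2.step prog) n a b → total b.stk ≤ total a.stk + C * n := by
  refine ⟨∑ l, pushes (prog l), fun n a b h => ?_⟩
  induction h with
  | refl a => simp
  | @head n a b c hab _ ih =>
    have h1 : total b.stk ≤ total a.stk + ∑ l, pushes (prog l) := by
      obtain ⟨l, v, S⟩ := a
      cases l with
      | none => cases hab
      | some l =>
        simp only [TM2.step, Option.some.injEq] at hab
        subst hab
        refine (total_stepAux_le _ _ _).trans (Nat.add_le_add_left ?_ _)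
        exact Finset.single_le_sum (f := fun l => pushes (prog l)) (fun _ _ => Nat.zero_le _)
          (Finset.mem_univ l)
    rw [Nat.mul_succ]
    omega

end total

/-! ### Program fragments -/

/-- A program fragment: a machine without designated inputs, outputs, and acceptance. -/
structure Frag (K : Type) where
  Λ : Type
  [finΛ : Fintype Λ]
  main : Λ
  σ : Type
  [finσ : Fintype σ]
  start : σ
  prog : Λ → BStmt K Λ σ

attribute [instance] Frag.finΛ Frag.finσ

namespace Frag

variable {K K' : Type} [DecidableEq K] [DecidableEq K']

/-- Started on the stacks `S`, the fragment halts within `t` steps with the stacks `S'`. -/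
def Runs (F : Frag K) (S : K → Str) (t : ℕ) (S' : K → Str) : Prop :=
  ∃ n ≤ t, ∃ v, StepsTo (TM2.step F.prog) n ⟨some F.main, F.start, S⟩ ⟨none, v, S'⟩

theorem Runs.mono {F : Frag K} {S S' : K → Str} {t t' : ℕ} (h : F.Runs S t S') (ht : t ≤ t') :
    F.Runs S t' S' := by
  obtain ⟨n, hn, v, hv⟩ := h
  exact ⟨n, hn.trans ht, v, hv⟩

theorem exists_total_runs_le [Fintype K] (F : Frag K) :
    ∃ C, ∀ S t S', F.Runs S t S' → total S' ≤ total S + C * t := by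
  obtain ⟨C, hC⟩ := exists_total_le F.prog
  refine ⟨C, fun S t S' ⟨n, hn, v, h⟩ => (hC _ _ _ h).trans ?_⟩
  exact Nat.add_le_add_left (Nat.mul_le_mul_left C hn) _

/-- A fragment consisting of a single statement. -/
def atom (q : BStmt K Unit Unit) : Frag K := ⟨Unit, (), Unit, (), fun _ => q⟩

theorem atom_runs {q : BStmt K Unit Unit} {S S' : K → Str}
    (h : TM2.stepAux q () S = ⟨none, (), S'⟩) : (atom q).Runs S 1 S' :=
  ⟨1, le_rfl, (), .single (congrArg some h)⟩

/-- The same fragment, acting on some of a larger family of stacks. -/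
def map (F : Frag K) (e : K ↪ K') : Frag K' where
  Λ := F.Λ
  main := F.main
  σ := F.σ
  start := F.start
  prog := fun l => Emb.stmt (Λ' := F.Λ) (σ' := F.σ)
    ⟨e, id, id, fun s _ => s, fun _ _ => rfl, fun _ _ _ => rfl, fun _ => rfl⟩ .halt (F.prog l)

theorem Runs.map {F : Frag K} (e : K ↪ K') {S S' : K' → Str} {t : ℕ}
    (h : F.Runs (S ∘ e) t (S' ∘ e)) (h' : ∀ k, k ∉ Set.range e → S' k = S k) :
    (F.map e).Runs S t S' := by
  obtain ⟨n, hn, v, h⟩ := h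
  refine ⟨n, hn, v, ?_⟩
  have := Emb.stepsTo (Λ' := F.Λ) (σ' := F.σ)
    ⟨e, id, id, fun s _ => s, fun _ _ => rfl, fun _ _ _ => rfl, fun _ => rfl⟩ .halt
    (prog' := (F.map e).prog) (fun _ => rfl) h rfl (v' := F.start) (S' := S) rfl rfl
  rw [Emb.cfg] at this
  simp only [Emb.eq_extend e rfl h', TM2.stepAux] at this
  exact this

/-! ### Flowcharts -/

/-- The first letter on the stack to be tested. -/
def peekAt (k : Option K) (S : K → Str) : Option Bool := k.bind fun k => (S k).head?

section graph

variable {I : Type} [DecidableEq I] (F : I → Frag K) (test : I → Option K)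
  (next : I → Option Bool → Option I)

/-- The memory of a flowchart. -/
abbrev GMem : Type := Option Bool × ∀ i, (F i).σ

/-- The jump at the end of the fragment at a node of a flowchart. -/
def jump (i : I) : BStmt K (Σ i, (F i).Λ) (GMem F) :=
  let q : BStmt K (Σ i, (F i).Λ) (GMem F) :=
    .branch (fun v => (next i v.1).isSome)
      (.load (fun v => (v.1, update v.2 ((next i v.1).getD i) (F ((next i v.1).getD i)).start))
        (.goto fun v => ⟨(next i v.1).getD i, (F ((next i v.1).getD i)).main⟩))
      .halt
  match test i with
  | none => .load (fun v => (none, v.2)) q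
  | some k => .peek k (fun v o => (o, v.2)) q

/-- The embedding of a fragment into a flowchart. -/
def nodeEmb (i : I) : Emb K (F i).Λ (F i).σ K (Σ i, (F i).Λ) (GMem F) where
  stk := .refl K
  lab := fun l => ⟨i, l⟩
  get := fun v => v.2 i
  set := fun s v => (v.1, update v.2 i s)
  get_set := by simp
  set_set := by simp
  set_get := by simp

/-- The program of a flowchart. -/
def graphProg (l : Σ i, (F i).Λ) : BStmt K (Σ i, (F i).Λ) (GMem F) :=
  (nodeEmb F l.1).stmt (jump F test next l.1) ((F l.1).prog l.2)

/-- A flowchart halts when it is started at a given node. -/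
def RunsFrom (i : I) (S : K → Str) (t : ℕ) (S' : K → Str) : Prop :=
  ∀ v : GMem F, v.2 i = (F i).start → ∃ n ≤ t, ∃ v',
    StepsTo (TM2.step (graphProg F test next)) n ⟨some ⟨i, (F i).main⟩, v, S⟩ ⟨none, v', S'⟩

variable {F test next}

theorem node_stepsTo {i : I} {S S' : K → Str} {t : ℕ} (h : (F i).Runs S t S')
    (v : GMem F) (hv : v.2 i = (F i).start) : ∃ n ≤ t, ∃ v' : GMem F,
    StepsTo (TM2.step (graphProg F test next)) n ⟨some ⟨i, (F i).main⟩, v, S⟩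
      (TM2.stepAux (jump F test next i) v' S') := by
  obtain ⟨n, hn, w, h⟩ := h
  refine ⟨n, hn, (nodeEmb F i).set w v, ?_⟩
  have := (nodeEmb F i).stepsTo (jump F test next i) (prog' := graphProg F test next)
    (fun _ => rfl) h rfl (v' := v) (S' := S) hv rfl
  have e : extend (Embedding.refl K) S' S = S' := Emb.eq_extend _ rfl (by simp)
  simp only [Emb.cfg] at this
  erw [e] at this
  exact this

/-- The memory of the target fragment is reset by the jump; a node can therefore be entered
repeatedly, as loops require. -/
theorem stepAux_jump (i : I) (v : GMem F) (S : K → Str) :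
    TM2.stepAux (jump F test next i) v S = match next i (peekAt (test i) S) with
      | none => ⟨none, (peekAt (test i) S, v.2), S⟩
      | some j => ⟨some ⟨j, (F j).main⟩, (peekAt (test i) S, update v.2 j (F j).start), S⟩ := by
  cases h : test i with
  | none =>
    simp only [jump, h, peekAt, Option.bind_none, TM2.stepAux]
    generalize next i none = o
    cases o <;> rfl
  | some k =>
    simp only [jump, h, peekAt, Option.bind_some, TM2.stepAux]
    generalize next i (S k).head? = o
    cases o <;> rfl

theorem RunsFrom.halt {i : I} {S S' : K → Str} {t : ℕ} (h : (F i).Runs S t S')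
    (hn : next i (peekAt (test i) S') = none) : RunsFrom F test next i S t S' := by
  intro v hv
  obtain ⟨n, hnt, v', h⟩ := node_stepsTo (test := test) (next := next) h v hv
  rw [stepAux_jump, hn] at h
  exact ⟨n, hnt, _, h⟩

theorem RunsFrom.step {i j : I} {S S₁ S' : K → Str} {t t' : ℕ} (h : (F i).Runs S t S₁)
    (hn : next i (peekAt (test i) S₁) = some j) (h' : RunsFrom F test next j S₁ t' S') :
    RunsFrom F test next i S (t + t') S' := by
  intro v hv
  obtain ⟨n, hnt, v', h⟩ := node_stepsTo (test := test) (next := next) h v hv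
  rw [stepAux_jump, hn] at h
  obtain ⟨n', hnt', v'', h''⟩ := h' (peekAt (test i) S₁, update v'.2 j (F j).start) (by simp)
  exact ⟨n + n', add_le_add hnt hnt', v'', h.trans h''⟩

/-- A flowchart: after the fragment `F i` has halted, the stack `test i` is inspected, and
`next i` is the fragment to be executed next. -/
def graph [Fintype I] (F : I → Frag K) (test : I → Option K) (next : I → Option Bool → Option I)
    (entry : I) : Frag K where
  Λ := Σ i, (F i).Λ
  main := ⟨entry, (F entry).main⟩
  σ := GMem F
  start := (none, fun i => (F i).start)
  prog := graphProg F test next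

theorem RunsFrom.runs [Fintype I] {i : I} {S S' : K → Str} {t : ℕ} (h : RunsFrom F test next i S t S') :
    (graph F test next i).Runs S t S' := h _ rfl

end graph

/-! ### Sequences, case distinctions, loops -/

/-- Execute one fragment after the other. -/
def seq (F₁ F₂ : Frag K) : Frag K :=
  graph (fun b : Bool => cond b F₂ F₁) (fun _ => none) (fun b _ => cond b none (some true)) false

theorem Runs.seq {F₁ F₂ : Frag K} {S S₁ S₂ : K → Str} {t₁ t₂ : ℕ} (h₁ : F₁.Runs S t₁ S₁)
    (h₂ : F₂.Runs S₁ t₂ S₂) : (F₁.seq F₂).Runs S (t₁ + t₂) S₂ :=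
  (RunsFrom.step (i := false) (j := true) (F := fun b : Bool => cond b F₂ F₁) h₁ rfl
    (RunsFrom.halt h₂ rfl)).runs

/-- Execute a fragment that depends on the first letter of the stack `k`. -/
def case (k : K) (F : Option Bool → Frag K) : Frag K :=
  graph (fun i : Option (Option Bool) => i.elim (atom .halt) F) (fun _ => some k)
    (fun i o => i.elim (some (some o)) fun _ => none) none

theorem Runs.case {k : K} {F : Option Bool → Frag K} {S S' : K → Str} {t : ℕ}
    (h : (F (S k).head?).Runs S t S') : (case k F).Runs S (1 + t) S' :=
  (RunsFrom.step (i := none) (j := some (S k).head?)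
    (F := fun i : Option (Option Bool) => i.elim (atom .halt) F) (S₁ := S) (atom_runs rfl) rfl
    (RunsFrom.halt h rfl)).runs

/-- Until the stack `k` is empty, remove its first letter `b` and execute the fragment `F b`. -/
def forEach (k : K) (F : Bool → Frag K) : Frag K :=
  graph (fun i : Option Bool => i.elim (atom .halt)
      fun b => (atom (.pop k (fun v _ => v) .halt)).seq (F b))
    (fun _ => some k) (fun i o => i.elim o fun _ => some none) none

/-- The loop `forEach`, halting within the given time. -/
inductive Loop (k : K) (F : Bool → Frag K) : (K → Str) → ℕ → (K → Str) → Prop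
  | nil {S : K → Str} : S k = [] → Loop k F S 1 S
  | cons {S S₁ S₂ : K → Str} {b : Bool} {l : Str} {t₁ t₂ : ℕ} : S k = b :: l →
      (F b).Runs (update S k l) t₁ S₁ → Loop k F S₁ t₂ S₂ → Loop k F S (t₁ + 2 + t₂) S₂

theorem Loop.runs {k : K} {F : Bool → Frag K} {S S' : K → Str} {t : ℕ} (h : Loop k F S t S') :
    (forEach k F).Runs S t S' := by
  refine RunsFrom.runs ?_
  induction h with
  | nil h => exact RunsFrom.halt (atom_runs rfl) (by simp [peekAt, h])
  | @cons S S₁ S₂ b l t₁ t₂ h h₁ h₂ ih =>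
    have hb : ((atom (.pop k (fun v _ => v) .halt)).seq (F b)).Runs S (1 + t₁) S₁ :=
      Runs.seq (atom_runs (S' := update S k l) (by simp [h])) h₁
    have h3 := RunsFrom.step (i := none) (j := some b) (F := fun i : Option Bool =>
      i.elim (atom .halt) fun b => (atom (.pop k (fun v _ => v) .halt)).seq (F b)) (S₁ := S)
      (test := fun _ => some k) (next := fun i o => i.elim o fun _ => some none)
      (atom_runs rfl) (by simp [peekAt, h]) (RunsFrom.step hb rfl ih)
    rw [show t₁ + 2 + t₂ = 1 + (1 + t₁ + t₂) by omega]
    exact h3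

end Frag

/-- The coefficients are natural numbers. -/
theorem eval_mono (p : Polynomial ℕ) {m n : ℕ} (h : m ≤ n) : p.eval m ≤ p.eval n := by
  simp only [Polynomial.eval_eq_sum, Polynomial.sum]
  exact Finset.sum_le_sum fun i _ => Nat.mul_le_mul_left _ (Nat.pow_le_pow_left h i)

theorem total_elim_nil {κ H : Type} [Fintype κ] [Fintype H] (S : κ → Str) :
    total (Sum.elim S fun _ : H => []) = total S := by
  simp [total]

theorem total_option {κ : Type} [Fintype κ] (S : Option κ → Str) :
    total S = (S none).length + total fun k => S (some k) := by
  simp [total, Fintype.sum_option]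

/-- A fragment acting on some of the strings, and with more additional stacks. -/
theorem Frag.Runs.frame {κ κ' H H' : Type} [DecidableEq κ] [DecidableEq κ']
    [DecidableEq H] [DecidableEq H'] {F : Frag (κ ⊕ H)}
    (e : κ ↪ κ') (e' : H ↪ H') {S T : κ' → Str} {t : ℕ}
    (h : F.Runs (Sum.elim (S ∘ e) fun _ => []) t (Sum.elim (T ∘ e) fun _ => []))
    (h' : ∀ k, k ∉ Set.range e → T k = S k) :
    (F.map (e.sumMap e')).Runs (Sum.elim S fun _ => []) t (Sum.elim T fun _ => []) := by
  have key : ∀ S : κ' → Str, (Sum.elim S fun _ : H' => []) ∘ (e.sumMap e') =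
      Sum.elim (S ∘ e) fun _ : H => [] := by
    intro S; funext k; cases k <;> rfl
  apply Frag.Runs.map
  · rwa [key, key]
  · rintro (k | k) hk
    · exact h' k fun ⟨j, hj⟩ => hk ⟨.inl j, by simp [hj]⟩
    · rfl

/-! ### Polynomial-time transformations of families of strings -/

section PT

variable {κ κ' : Type} [Fintype κ] [DecidableEq κ] [Fintype κ'] [DecidableEq κ']

/-- The transformation `R` of families of strings is carried out in place, in polynomial time, by
a fragment that may use additional stacks, which are empty before and afterwards.  This is required
for arguments that satisfy `P` only. -/
def PTOn (P : (κ → Str) → Prop) (R : (κ → Str) → κ → Str) : Prop :=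
  ∃ (H : Type) (_ : Fintype H) (_ : DecidableEq H) (F : Frag (κ ⊕ H)) (p : Polynomial ℕ),
    ∀ S, P S → F.Runs (Sum.elim S fun _ => []) (p.eval (total S)) (Sum.elim (R S) fun _ => [])

/-- Polynomial-time transformations of families of strings. -/
abbrev PT (R : (κ → Str) → κ → Str) : Prop := PTOn (fun _ => True) R

namespace PTOn

variable {P Q : (κ → Str) → Prop} {R R' R₁ R₂ : (κ → Str) → κ → Str}

theorem mono (h : PTOn P R) (hQ : ∀ S, Q S → P S) (hR : ∀ S, Q S → R S = R' S) :
    PTOn Q R' := by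
  obtain ⟨H, _, _, F, p, hF⟩ := h
  exact ⟨H, inferInstance, inferInstance, F, p, fun S hS => hR S hS ▸ hF S (hQ S hS)⟩

theorem congr (h : PTOn P R) (hR : ∀ S, R S = R' S) : PTOn P R' :=
  h.mono (fun _ => id) fun S _ => hR S

theorem exists_total_le (h : PTOn P R) :
    ∃ q : Polynomial ℕ, ∀ S, P S → total (R S) ≤ q.eval (total S) := by
  obtain ⟨H, _, _, F, p, hF⟩ := h
  obtain ⟨C, hC⟩ := F.exists_total_runs_le
  refine ⟨Polynomial.X + Polynomial.C C * p, fun S hS => ?_⟩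
  have := hC _ _ _ (hF S hS)
  simpa [total_elim_nil] using this

/-- The two fragments use disjoint sets of additional stacks. The time bound of the second is
evaluated at a polynomial bound for the size of the intermediate result. -/
theorem comp (h₁ : PTOn P R₁) (h₂ : PTOn Q R₂) (h : ∀ S, P S → Q (R₁ S)) :
    PTOn P fun S => R₂ (R₁ S) := by
  obtain ⟨q, hq⟩ := h₁.exists_total_le
  obtain ⟨H₁, _, _, F₁, p₁, hF₁⟩ := h₁
  obtain ⟨H₂, _, _, F₂, p₂, hF₂⟩ := h₂
  refine ⟨H₁ ⊕ H₂, inferInstance, inferInstance, (F₁.map ((Embedding.refl κ).sumMap .inl)).seq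
    (F₂.map ((Embedding.refl κ).sumMap .inr)), p₁ + p₂.comp q, fun S hS => ?_⟩
  rw [Polynomial.eval_add, Polynomial.eval_comp]
  refine Frag.Runs.seq (Frag.Runs.frame _ _ (hF₁ S hS) (by simp))
    (Frag.Runs.frame _ _ (S := R₁ S) ?_ (by simp))
  exact (hF₂ _ (h S hS)).mono (eval_mono _ (hq S hS))

theorem frame (h : PTOn P R) {e : κ → κ'} (he : Function.Injective e)
    {P' : (κ' → Str) → Prop}
    {R' : (κ' → Str) → κ' → Str} (hP : ∀ S, P' S → P fun k => S (e k))
    (hR : ∀ S, P' S → ∀ k, R' S (e k) = R (fun k => S (e k)) k)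
    (h' : ∀ S, P' S → ∀ k, (∀ j, e j ≠ k) → R' S k = S k) : PTOn P' R' := by
  obtain ⟨H, _, _, F, p, hF⟩ := h
  refine ⟨H, inferInstance, inferInstance, F.map (Embedding.sumMap ⟨e, he⟩ (.refl H)), p, fun S hS => ?_⟩
  apply Frag.Runs.frame ⟨e, he⟩
  · change F.Runs (Sum.elim (S ∘ e) _) _ (Sum.elim (R' S ∘ e) _)
    rw [show R' S ∘ e = R (S ∘ e) from funext (hR S hS)]
    refine (hF _ (hP S hS)).mono (eval_mono _ ?_)
    exact total_comp_le S he
  · intro k hk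
    exact h' S hS k fun j hj => hk ⟨j, hj⟩

/-- Some of the strings may be regarded as additional stacks. -/
theorem hide {η : Type} [Fintype η] [DecidableEq η] {P : (κ ⊕ η → Str) → Prop}
    {R : (κ ⊕ η → Str) → κ ⊕ η → Str} {Q : (κ → Str) → Prop} {R' : (κ → Str) → κ → Str}
    (h : PTOn P R) (hQ : ∀ S, Q S → P (Sum.elim S fun _ => []))
    (hR : ∀ S, Q S → R (Sum.elim S fun _ => []) = Sum.elim (R' S) fun _ => []) :
    PTOn Q R' := by
  obtain ⟨H, _, _, F, p, hF⟩ := h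
  refine ⟨η ⊕ H, inferInstance, inferInstance,
    F.map (Equiv.sumAssoc κ η H).toEmbedding, p, fun S hS => ?_⟩
  have key : ∀ S : κ → Str, (Sum.elim S fun _ : η ⊕ H => []) ∘ (Equiv.sumAssoc κ η H) =
      Sum.elim (Sum.elim S fun _ => []) fun _ => [] := by
    intro S; funext k; rcases k with (k | k) | k <;> rfl
  apply Frag.Runs.map
  · have := hF _ (hQ S hS)
    rw [hR S hS, total_elim_nil] at this
    erw [key, key]
    exact this
  · intro k hk
    exact absurd ⟨_, (Equiv.sumAssoc κ η H).apply_symm_apply k⟩ hk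

end PTOn

/-! ### Basic transformations, case distinctions and loops -/

namespace PT

variable {R R' R₁ R₂ : (κ → Str) → κ → Str}

theorem comp (h₁ : PT R₁) (h₂ : PT R₂) : PT fun S => R₂ (R₁ S) :=
  PTOn.comp h₁ h₂ fun _ _ => trivial

theorem atom {q : BStmt κ Unit Unit} (h : ∀ S, TM2.stepAux q () S = ⟨none, (), R S⟩) : PT R := by
  refine ⟨Empty, inferInstance, inferInstance, (Frag.atom q).map ⟨.inl, Sum.inl_injective⟩, 1,
    fun S _ => ?_⟩
  simp only [Polynomial.eval_one]
  exact (Frag.atom_runs (h S)).map _ (by simp)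

protected theorem id : PT fun S : κ → Str => S :=
  atom (q := .halt) fun _ => rfl

theorem push (k : κ) (b : Bool) : PT fun S : κ → Str => update S k (b :: S k) :=
  atom (q := .push k (fun _ => b) .halt) fun _ => rfl

theorem pop (k : κ) : PT fun S : κ → Str => update S k (S k).tail :=
  atom (q := .pop k (fun v _ => v) .halt) fun _ => rfl

theorem case (k : κ) {R : Option Bool → (κ → Str) → κ → Str} (h : ∀ o, PT (R o)) :
    PT fun S => R (S k).head? S := by
  choose H i₁ i₂ F p hF using h
  refine ⟨Σ o, H o, inferInstance, inferInstance, Frag.case (.inl k) fun o =>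
    (F o).map ((Embedding.refl κ).sumMap (.sigmaMk o)), 1 + ∑ o, p o, fun S _ => ?_⟩
  rw [Polynomial.eval_add, Polynomial.eval_one]
  refine Frag.Runs.case ((Frag.Runs.frame _ _ (hF (S k).head? S trivial) (by simp)).mono ?_)
  rw [Polynomial.eval_finsetSum]
  exact Finset.single_le_sum (f := fun o => (p o).eval (total S)) (fun _ _ => Nat.zero_le _)
    (Finset.mem_univ _)

/-- The family of strings `s`, together with another string `x`. -/
def ocons (x : Str) (s : κ → Str) : Option κ → Str := fun k => k.elim x s

/-- A loop over the letters of a string; the sizes must remain polynomially bounded. -/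
theorem forEach {R : Bool → (κ → Str) → κ → Str} (h : ∀ b, PT (R b)) {q : Polynomial ℕ}
    (hq : ∀ (l : Str) (s : κ → Str),
      total (l.foldl (fun s b => R b s) s) ≤ q.eval (l.length + total s)) :
    PT fun S : Option κ → Str =>
      ocons [] ((S none).foldl (fun s b => R b s) fun k => S (some k)) := by
  choose H i₁ i₂ F p hF using h
  set G : Bool → Frag (Option κ ⊕ Σ b, H b) := fun b =>
    (F b).map (Embedding.some.sumMap (.sigmaMk b)) with hG
  -- `B` bounds the sizes at all intermediate stages of the loop, so that one time bound serves for
  -- every iteration. The summand 2 is for the test and the removal of the first letter, the summand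
  -- 1 for the last test.
  have key : ∀ (l : Str) (s : κ → Str) (B : ℕ),
      (∀ l' l'', l = l' ++ l'' → total (l'.foldl (fun s b => R b s) s) ≤ B) →
      ∃ t ≤ 1 + l.length * ((∑ b, p b).eval B + 2), Frag.Loop (.inl none) G
        (Sum.elim (ocons l s) fun _ => []) t
        (Sum.elim (ocons [] (l.foldl (fun s b => R b s) s)) fun _ => []) := by
    intro l
    induction l with
    | nil => intro s B _; exact ⟨1, by simp, .nil rfl⟩
    | cons b l ih =>
      intro s B hB
      obtain ⟨t, ht, hl⟩ := ih (R b s) B fun l' l'' e => hB (b :: l') l'' (by simp [e])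
      refine ⟨(p b).eval (total s) + 2 + t, ?_, .cons rfl
        (S₁ := Sum.elim (ocons l (R b s)) fun _ => []) ?_ hl⟩
      · have h1 : (p b).eval (total s) ≤ (∑ b, p b).eval B := by
          rw [Polynomial.eval_finsetSum]
          exact (eval_mono _ (hB [] _ rfl)).trans
            (Finset.single_le_sum (f := fun b => (p b).eval B) (fun _ _ => Nat.zero_le _)
              (Finset.mem_univ b))
        rw [List.length_cons, Nat.succ_mul]
        omega
      · have e1 : update (Sum.elim (ocons (b :: l) s) fun _ : Σ b, H b => []) (.inl none) l =
            Sum.elim (ocons l s) fun _ => [] := by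
          funext k
          rcases k with (_ | k) | k <;> rfl
        rw [e1]
        refine Frag.Runs.frame _ _ (hF b s trivial) ?_
        rintro (_ | k) hk
        · rfl
        · exact absurd ⟨k, rfl⟩ hk
  refine ⟨Σ b, H b, inferInstance, inferInstance, Frag.forEach (.inl none) G,
    1 + Polynomial.X * ((∑ b, p b).comp q + 2), fun S _ => ?_⟩
  obtain ⟨t, ht, hl⟩ := key (S none) (fun k => S (some k)) (q.eval (total S)) (by
    intro l' l'' e
    refine (hq _ _).trans (eval_mono _ ?_)
    rw [total_option, e, List.length_append]
    omega)
  have e2 : S = ocons (S none) fun k => S (some k) := by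
    funext k; cases k <;> rfl
  rw [← e2] at hl
  refine hl.runs.mono (ht.trans ?_)
  simp only [Polynomial.eval_add, Polynomial.eval_mul, Polynomial.eval_comp, Polynomial.eval_X,
    Polynomial.eval_one, Polynomial.eval_ofNat]
  refine Nat.add_le_add_left (Nat.mul_le_mul_right _ ?_) _
  exact length_le_total S none

end PT

end PT

/-! ### Moving, clearing and copying strings -/

namespace PT

variable {κ κ' : Type} [Fintype κ] [DecidableEq κ] [Fintype κ'] [DecidableEq κ']

theorem frame {R : (κ → Str) → κ → Str} (h : PT R) {e : κ → κ'} (he : Function.Injective e)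
    {R' : (κ' → Str) → κ' → Str}
    (hR : ∀ S k, R' S (e k) = R (fun k => S (e k)) k)
    (h' : ∀ S k, (∀ j, e j ≠ k) → R' S k = S k) : PT R' :=
  PTOn.frame h he (fun _ _ => trivial) (fun S _ => hR S) fun S _ => h' S

/-- The strings are changed one after the other; the order is irrelevant because `g` reads only the
string that it replaces. -/
theorem pointwise {g : Str → Str} (h : ∀ k : κ, PT fun S : κ → Str => update S k (g (S k)))
    (s : Finset κ) : PT fun (S : κ → Str) k => if k ∈ s then g (S k) else S k := by
  induction s using Finset.induction_on with
  | empty => simpa using PT.id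
  | insert a s ha ih =>
    refine (ih.comp (h a)).congr fun S => ?_
    funext k
    by_cases hk : k = a
    · subst hk; simp [ha]
    · simp [hk]

/-- The values are written to the right half while the arguments in the left half remain intact, so
that successive assignments amount to a simultaneous one. -/
theorem pairing {f : κ' → (κ → Str) → Str}
    (h : ∀ k, PT fun S : κ ⊕ κ' → Str => update S (.inr k) (f k fun i => S (.inl i))) :
    PT fun S : κ ⊕ κ' → Str => Sum.elim (fun i => S (.inl i)) fun k => f k fun i => S (.inl i) := by
  have key : ∀ s : Finset κ', PT fun S : κ ⊕ κ' → Str => Sum.elim (fun i => S (.inl i))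
      fun k => if k ∈ s then f k fun i => S (.inl i) else S (.inr k) := by
    intro s
    induction s using Finset.induction_on with
    | empty =>
      refine PT.id.congr fun S => ?_
      funext k; cases k <;> simp
    | insert a s ha ih =>
      refine (ih.comp (h a)).congr fun S => ?_
      funext k
      rcases k with k | k
      · simp
      · by_cases hk : k = a
        · subst hk; simp
        · simp [hk]
  simpa using key Finset.univ

/-- This is the basic loop: each letter is removed from one stack and pushed on all others.
Clearing, copying and reversing are instances of it. -/
theorem moveReverse : PT fun S : Option κ → Str =>
    ocons [] fun k => (S none).reverse ++ S (some k) := by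
  have key : ∀ (l : Str) (s : κ → Str),
      l.foldl (fun s b k => b :: s k) s = fun k => l.reverse ++ s k := by
    intro l
    induction l with
    | nil => intro s; simp
    | cons b l ih => intro s; simp [ih]
  refine (forEach (R := fun b s k => b :: s k) (q := ((Fintype.card κ + 1 : ℕ) : Polynomial ℕ) * Polynomial.X)
    (fun b => ?_) fun l s => ?_).congr fun S => ?_
  · simpa using pointwise (push · b) Finset.univ
  · rw [key]
    simp only [total, List.length_append, List.length_reverse, Finset.sum_add_distrib,
      Finset.sum_const, Finset.card_univ, smul_eq_mul, Polynomial.eval_mul, Polynomial.eval_X,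
      Polynomial.eval_natCast, Nat.cast_id]
    nlinarith [Nat.zero_le (Fintype.card κ * ∑ k, (s k).length)]
  · rw [key]

/-- A string that is moved to an empty family of stacks is discarded. -/
theorem clear (k : κ) : PT fun S : κ → Str => update S k [] := by
  refine (moveReverse (κ := Empty)).frame (e := fun _ => k)
    (fun a b _ => Subsingleton.elim a b)
    (fun S j => ?_) fun S j hj => ?_
  · rcases j with _ | ⟨⟨⟩⟩
    simp [ocons]
  · exact update_of_ne (fun e => hj none e.symm) _ _

theorem clearInr : PT fun S : κ ⊕ κ' → Str => Sum.elim (fun i => S (.inl i)) fun _ => [] :=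
  pairing (f := fun _ _ => []) fun k => clear (Sum.inr k)

/-- The string is moved to an auxiliary stack and from there to both `i` and `j`, which cancels the
reversal. Since moving prepends to what is there, `j` is emptied first. -/
theorem copy {i j : κ} (hij : i ≠ j) : PT fun S : κ → Str => update S j (S i) := by
  have h1 : PT fun S : κ ⊕ Unit → Str => update S (.inl j) [] := clear _
  have h2 : PT fun S : κ ⊕ Unit → Str =>
      update (update S (.inl i) []) (.inr ()) ((S (.inl i)).reverse ++ S (.inr ())) := by
    refine (moveReverse (κ := Unit)).frame
      (e := fun o => o.elim (.inl i) fun _ => .inr ()) ?_ (fun S k => ?_) fun S k hk => ?_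
    · rintro (_ | _) (_ | _) h <;> simp_all
    · rcases k with _ | _ <;> simp [ocons]
    · have h1 := hk none
      have h2 := hk (some ())
      simp only [Option.elim] at h1 h2
      rw [update_of_ne h2.symm, update_of_ne h1.symm]
  have h3 : PT fun S : κ ⊕ Unit → Str =>
      update (update (update S (.inr ()) []) (.inl i) ((S (.inr ())).reverse ++ S (.inl i)))
        (.inl j) ((S (.inr ())).reverse ++ S (.inl j)) := by
    refine (moveReverse (κ := Bool)).frame
      (e := fun o => o.elim (.inr ()) fun b => .inl (cond b i j)) ?_ (fun S k => ?_) fun S k hk => ?_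
    · rintro (_ | _ | _) (_ | _ | _) h <;> simp_all [hij.symm]
    · rcases k with _ | _ | _ <;> simp [ocons, hij]
    · have h1 := hk none
      have h2 := hk (some true)
      have h3 := hk (some false)
      simp only [Option.elim, cond] at h1 h2 h3
      rw [update_of_ne h3.symm, update_of_ne h2.symm, update_of_ne h1.symm]
  refine PTOn.hide ((h1.comp h2).comp h3) (fun _ _ => trivial) fun S _ => ?_
  funext k
  rcases k with k | k
  · simp only [update_apply, Sum.elim_inl, Sum.elim_inr, Sum.inl.injEq, reduceCtorEq, if_true,
      if_false, hij, List.reverse_reverse, List.append_nil]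
    by_cases h1 : k = j
    · simp [h1]
    · by_cases h2 : k = i
      · simp [h2, hij]
      · simp [h1, h2]
  · simp only [update_apply, Sum.elim_inr, reduceCtorEq, if_true, if_false]

end PT

/-! ### Polynomial-time functions -/

section PF

variable {ι ι' κ : Type} [Fintype ι] [DecidableEq ι] [Fintype ι'] [DecidableEq ι'] [Fintype κ]
  [DecidableEq κ]

/-- Total polynomial-time functions from families of strings to strings. -/
def PF (f : (ι → Str) → Str) : Prop :=
  PT fun S : Option ι → Str => update S none (f fun i => S (some i))

theorem PF.congr {f g : (ι → Str) → Str} (h : PF f) (hfg : ∀ S, f S = g S) : PF g :=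
  PTOn.congr h fun S => by rw [hfg]

theorem PF.proj (i : ι) : PF fun S => S i :=
  PT.copy (i := some i) (j := none) (by simp)

theorem PF.nil : PF fun _ : ι → Str => [] := PT.clear none

/-- The value of a polynomial-time function may be assigned to a further string. -/
theorem PF.assign {f : (ι → Str) → Str} (h : PF f) (e : ι ↪ κ) (j : κ) (hj : ∀ i, e i ≠ j) :
    PT fun S : κ → Str => update S j (f fun i => S (e i)) := by
  refine PT.frame h (e := fun o => o.elim j e) ?_ (fun S k => ?_) fun S k hk => ?_
  · rintro (_ | a) (_ | b) hab
    · rfl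
    · exact absurd hab.symm (hj b)
    · exact absurd hab (hj a)
    · simpa using hab
  · rcases k with _ | k
    · simp
    · simp [hj]
  · exact update_of_ne (hk none).symm _ _

theorem PT.pairingPF {f : κ → (ι → Str) → Str} (h : ∀ k, PF (f k)) :
    PT fun S : ι ⊕ κ → Str => Sum.elim (fun i => S (.inl i)) fun k => f k fun i => S (.inl i) :=
  PT.pairing fun k => (h k).assign .inl (.inr k) (by simp)

/-- A transformation of families of strings, applied to the values of polynomial-time functions. -/
theorem PTOn.pf {P : (κ → Str) → Prop} {R : (κ → Str) → κ → Str} (hR : PTOn P R)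
    {f : κ → (ι → Str) → Str} (h : ∀ k, PF (f k)) (hP : ∀ S, P fun k => f k S) (j : κ) :
    PF fun S => R (fun k => f k S) j := by
  have h1 : PT fun S : Option ι ⊕ κ → Str => Sum.elim (fun i => S (.inl i))
      fun k => f k fun i => S (.inl (some i)) :=
    PT.pairing (f := fun k s => f k fun i => s (some i)) fun k =>
      (h k).assign (Embedding.some.trans .inl) (.inr k) (by simp)
  have h2 : PTOn (fun S : Option ι ⊕ κ → Str => P fun k => S (.inr k)) fun S =>
      Sum.elim (fun i => S (.inl i)) (R fun k => S (.inr k)) := by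
    refine PTOn.frame hR Sum.inr_injective (fun S h => h) (fun S _ k => rfl) fun S _ k hk => ?_
    rcases k with k | k
    · rfl
    · exact absurd rfl (hk k)
  have h3 : PT fun S : Option ι ⊕ κ → Str => update S (.inl none) (S (.inr j)) :=
    PT.copy (by simp)
  refine PTOn.hide (((PTOn.comp h1 h2 fun S _ => hP _).comp h3 fun _ _ => trivial).comp
    PT.clearInr fun _ _ => trivial) (fun _ _ => trivial) fun S _ => ?_
  funext k
  rcases k with (_ | k) | k <;> simp

theorem PF.comp {g : (ι' → Str) → Str} (hg : PF g) {f : ι' → (ι → Str) → Str}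
    (hf : ∀ i, PF (f i)) : PF fun S => g fun i => f i S := by
  refine (PTOn.pf hg (f := fun o => o.elim (fun _ => []) f) (fun o => ?_) (fun _ => trivial)
    none).congr fun S => ?_
  · cases o
    · exact PF.nil
    · exact hf _
  · simp

/-- Simultaneous assignment. -/
theorem PT.ofPF {R : (κ → Str) → κ → Str} (h : ∀ k, PF fun S => R S k) : PT R := by
  -- All new values are computed on a second copy of the stacks before any old value is overwritten.
  have h1 : PT fun S : κ ⊕ κ → Str => Sum.elim (fun i => S (.inr i)) fun i => S (.inr i) := by
    refine (PT.pairingPF (fun k : κ => PF.proj k)).frame (Equiv.sumComm κ κ).injective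
      (fun S k => ?_) fun S k hk => ?_
    · cases k <;> rfl
    · exact absurd ((Equiv.sumComm κ κ).apply_symm_apply k) (hk _)
  refine PTOn.hide (((PT.pairingPF h).comp h1).comp PT.clearInr) (fun _ _ => trivial)
    fun S _ => ?_
  funext k
  cases k <;> simp

theorem PF.cons (b : Bool) {f : (ι → Str) → Str} (hf : PF f) : PF fun S => b :: f S :=
  (PT.push () b).pf (f := fun _ => f) (fun _ => hf) (fun _ => trivial) ()
    |>.congr fun S => by simp

theorem PF.tail {f : (ι → Str) → Str} (hf : PF f) : PF fun S => (f S).tail :=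
  (PT.pop ()).pf (f := fun _ => f) (fun _ => hf) (fun _ => trivial) ()
    |>.congr fun S => by simp

theorem PF.const (l : Str) : PF fun _ : ι → Str => l := by
  induction l with
  | nil => exact PF.nil
  | cons b l ih => exact ih.cons b

theorem PF.case {c : (ι → Str) → Str} (hc : PF c) {f : Option Bool → (ι → Str) → Str}
    (hf : ∀ o, PF (f o)) : PF fun S => f (c S).head? S := by
  have h := PT.case (κ := Option (Option Bool)) none
    (R := fun o S => update S none (S (some o))) fun o => PT.copy (by simp)
  refine (h.pf (f := fun k => k.elim c f) (fun k => ?_) (fun _ => trivial) none).congr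
    fun S => by simp
  cases k
  · exact hc
  · exact hf _

theorem PF.foldl {R : Bool → (κ → Str) → κ → Str} (hR : ∀ b k, PF fun s => R b s k)
    {q : Polynomial ℕ} (hq : ∀ (l : Str) (s : κ → Str),
      total (l.foldl (fun s b => R b s) s) ≤ q.eval (l.length + total s))
    {l : (ι → Str) → Str} (hl : PF l) {s : (ι → Str) → κ → Str} (hs : ∀ k, PF fun S => s S k)
    (k : κ) : PF fun S => (l S).foldl (fun s b => R b s) (s S) k := by
  refine ((PT.forEach (fun b => PT.ofPF (hR b)) hq).pf
    (f := fun o S => o.elim (l S) (s S)) (fun o => ?_) (fun _ => trivial) (some k)).congr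
    fun S => rfl
  cases o
  · exact hl
  · exact hs _

end PF

/-! ### Calling a machine, and turning functions into machines -/

namespace TM

variable {m n : ℕ}

theorem HaltsWithin.stepsTo {M : TM m n} {x : Fin m → Str} {t : ℕ} {c : M.Cfg}
    (h : M.HaltsWithin x t c) : ∃ k ≤ t, StepsTo (TM2.step M.prog) k (M.init x) c :=
  StepsTo.nonempty_evalsToInTime_iff.1 h.1

/-- A machine as a program fragment, which writes whether it accepts on an additional stack. -/
def toFrag (M : TM m n) : Frag (Option M.K) where
  Λ := M.Λ
  main := M.main
  σ := M.σ
  start := M.start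
  prog := fun l => Emb.stmt (Λ' := M.Λ) (σ' := M.σ)
    ⟨.some, id, id, fun s _ => s, fun _ _ => rfl, fun _ _ _ => rfl, fun _ => rfl⟩
    (.push none M.acc .halt) (M.prog l)

theorem HaltsWithin.toFrag_runs {M : TM m n} {x : Fin m → Str} {t : ℕ} {c : M.Cfg}
    (h : M.HaltsWithin x t c) : M.toFrag.Runs (PT.ocons [] (extend M.inp x fun _ => [])) t
      (PT.ocons [M.acc c.var] c.stk) := by
  obtain ⟨k, hk, hs⟩ := h.stepsTo
  refine ⟨k, hk, c.var, ?_⟩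
  have := Emb.stepsTo (Λ' := M.Λ) (σ' := M.σ)
    ⟨.some, id, id, fun s _ => s, fun _ _ => rfl, fun _ _ _ => rfl, fun _ => rfl⟩
    (.push none M.acc .halt) (prog' := M.toFrag.prog) (fun _ => rfl) hs h.2 (v' := M.start)
    (S' := PT.ocons [] (extend M.inp x fun _ => [])) rfl rfl
  rw [Emb.cfg] at this
  have e : extend (Embedding.some : M.K ↪ Option M.K) c.stk
      (PT.ocons [] (extend M.inp x fun _ => [])) = PT.ocons [] c.stk :=
    Emb.eq_extend _ rfl (by rintro (_ | k) hk; · rfl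
                            · exact absurd ⟨k, rfl⟩ hk)
  simp only [h.2, e, TM2.stepAux] at this
  have e2 : update (PT.ocons [] c.stk) none [M.acc c.var] = PT.ocons [M.acc c.var] c.stk := by
    funext k; cases k <;> simp [PT.ocons]
  have e3 : PT.ocons [] c.stk none = [] := rfl
  simp only [e3] at this
  erw [e2] at this
  exact this

end TM

theorem PTOn.ofFrag {κ : Type} [Fintype κ] [DecidableEq κ] {P : (κ → Str) → Prop}
    {R : (κ → Str) → κ → Str} (F : Frag κ) (p : Polynomial ℕ)
    (h : ∀ S, P S → F.Runs S (p.eval (total S)) (R S)) : PTOn P R :=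
  ⟨Empty, inferInstance, inferInstance, F.map ⟨.inl, Sum.inl_injective⟩, p, fun S hS =>
    Frag.Runs.map (S := Sum.elim S fun _ => []) (S' := Sum.elim (R S) fun _ => []) _ (h S hS)
      (by simp)⟩

/-- The final configuration of a machine depends on the input in a polynomial-time computable way. -/
theorem PF.machine {m n : ℕ} (M : TM m n) (p : Polynomial ℕ) (c : (Fin m → Str) → M.Cfg)
    (hc : ∀ x, M.HaltsWithin x (p.eval (size x)) (c x)) (k : Option M.K) :
    PF fun x => PT.ocons [M.acc (c x).var] (c x).stk k := by
  have hinp : ∀ (x : Fin m → Str) i, extend M.inp x (fun _ => []) (M.inp i) = x i :=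
    fun x i => M.inp.injective.extend_apply _ _ _
  -- The machine is known to halt in time only from initial configurations, where all stacks other
  -- than the inputs are empty; this is the reason for the precondition in `PTOn`.
  have h : PTOn (fun S => ∃ x, S = PT.ocons [] (extend M.inp x fun _ => []))
      (fun S => PT.ocons [M.acc (c fun i => S (some (M.inp i))).var]
        (c fun i => S (some (M.inp i))).stk) := by
    refine PTOn.ofFrag M.toFrag p ?_
    rintro _ ⟨x, rfl⟩
    have e : (fun i => PT.ocons [] (extend M.inp x fun _ => []) (some (M.inp i))) = x :=
      funext (hinp x)
    rw [e]
    refine (hc x).toFrag_runs.mono (eval_mono _ ?_)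
    have := total_comp_le (PT.ocons [] (extend M.inp x fun _ => []))
      (e := fun i => some (M.inp i)) fun i j hij => M.inp.injective (by simpa using hij)
    rwa [e] at this
  refine (h.pf (f := fun k x => PT.ocons [] (extend M.inp x fun _ => []) k) (fun k => ?_)
    (fun x => ⟨x, rfl⟩) k).congr fun x => ?_
  · rcases k with _ | k
    · exact PF.nil
    · by_cases hk : ∃ i, M.inp i = k
      · obtain ⟨i, rfl⟩ := hk
        exact (PF.proj i).congr fun x => (hinp x i).symm
      · exact PF.nil.congr fun x => (extend_apply' x (fun _ => ([] : Str)) k hk).symm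
  · simp only [PT.ocons, Option.elim, hinp]

/-! ### Translation between machines and polynomial-time functions -/

namespace FP

variable {m n : ℕ} {F : (Fin m → Str) → Option (Fin n → Str)}

theorem exists_pf (hF : F ∈ FP m n) :
    PF (fun x => [(F x).isSome]) ∧ ∀ j, PF fun x => (F x).elim [] fun y => y j := by
  obtain ⟨M, p, h⟩ := hF
  choose c hc hF using h
  have h1 : PF fun x => [(F x).isSome] := (PF.machine M p c hc none).congr fun x => by
    rw [← hF x, TM.result]
    cases h : M.acc (c x).var <;> simp [PT.ocons]
  refine ⟨h1, fun j => ?_⟩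
  -- A rejecting computation may leave letters on its output stacks; these are replaced by the
  -- default value `[]`.
  refine (h1.case (f := fun o x => if o = some true then (c x).stk (M.out j) else [])
    fun o => ?_).congr fun x => ?_
  · by_cases ho : o = some true
    · exact (PF.machine M p c hc (some (M.out j))).congr fun x => by simp [ho, PT.ocons]
    · exact PF.nil.congr fun x => by simp [ho]
  · rw [← hF x, TM.result]
    cases h : M.acc (c x).var <;> simp

theorem isSome (hF : F ∈ FP m n) : PF fun x => [(F x).isSome] := (exists_pf hF).1

theorem value (hF : F ∈ FP m n) (j : Fin n) : PF fun x => (F x).elim [] fun y => y j :=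
  (exists_pf hF).2 j

/-- The machine obtained from a fragment that computes the status and the values of a function. -/
def ofFrag {H : Type} [Fintype H] [DecidableEq H]
    (F : Frag ((Fin m ⊕ Option (Fin n)) ⊕ H)) : TM m n where
  K := (Fin m ⊕ Option (Fin n)) ⊕ H
  inp := Embedding.inl.trans .inl
  out := fun j => .inl (.inr (some j))
  Λ := F.Λ
  main := F.main
  σ := F.σ × Bool
  start := (F.start, false)
  acc := Prod.snd
  prog := fun l => Emb.stmt (Λ' := F.Λ) (σ' := F.σ × Bool)
    ⟨.refl _, id, Prod.fst, fun s v => (s, v.2), fun _ _ => rfl, fun _ _ _ => rfl, fun _ => rfl⟩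
    (.peek (.inl (.inr none)) (fun v o => (v.1, o == some true)) .halt) (F.prog l)

/-- A fragment computes all values and the status `[b x]` on separate stacks. When it halts, a final
look at the status stack stores the status in the memory, where acceptance is read off. -/
theorem of_pf {b : (Fin m → Str) → Bool} (hb : PF fun x => [b x]) {v : Fin n → (Fin m → Str) → Str}
    (hv : ∀ j, PF (v j)) : (fun x => if b x then some fun j => v j x else none) ∈ FP m n := by
  obtain ⟨H, _, _, F, p, h⟩ := PT.pairingPF
    (f := fun o : Option (Fin n) => o.elim (fun x => [b x]) v) (by
      rintro (_ | j)
      · exact hb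
      · exact hv j)
  refine ⟨ofFrag F, p, fun x => ?_⟩
  have hr := h (Sum.elim x fun _ => []) trivial
  rw [total_elim_nil] at hr
  obtain ⟨k, hk, w, hs⟩ := hr
  set T : (Fin m ⊕ Option (Fin n)) ⊕ H → Str := Sum.elim (Sum.elim x
    fun o : Option (Fin n) => o.elim (fun x => [b x]) v x) fun _ => [] with hT
  have hinit : (ofFrag F).init x = ⟨some F.main, (F.start, false),
      Sum.elim (Sum.elim x fun _ => []) fun _ => []⟩ := by
    simp only [TM.init]
    congr 1
    refine Emb.eq_extend (Embedding.inl.trans .inl : Fin m ↪ (Fin m ⊕ Option (Fin n)) ⊕ H) rfl ?_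
    rintro ((i | j) | k) hk
    · exact absurd ⟨i, rfl⟩ hk
    · rfl
    · rfl
  have := Emb.stepsTo (Λ' := F.Λ) (σ' := F.σ × Bool)
    ⟨.refl _, id, Prod.fst, fun s v => (s, v.2), fun _ _ => rfl, fun _ _ _ => rfl, fun _ => rfl⟩
    (.peek (.inl (.inr none)) (fun v o => (v.1, o == some true)) .halt)
    (prog' := (ofFrag F).prog) (fun _ => rfl) hs rfl (v' := (F.start, false))
    (S' := Sum.elim (Sum.elim x fun _ => []) fun _ => []) rfl rfl
  simp only [Emb.cfg] at this
  have e : extend (Embedding.refl ((Fin m ⊕ Option (Fin n)) ⊕ H)) T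
      (Sum.elim (Sum.elim x fun _ => []) fun _ => []) = T := Emb.eq_extend _ rfl (by simp)
  refine ⟨⟨none, (w, b x), T⟩, ⟨StepsTo.nonempty_evalsToInTime_iff.2 ⟨k, hk, ?_⟩, rfl⟩, ?_⟩
  · rw [hinit]
    simp only [Sum.elim_inl] at this
    erw [e] at this
    simp only [TM2.stepAux, hT, Sum.elim_inl, Sum.elim_inr, Option.elim, List.head?_cons] at this
    cases hb : b x <;> rw [hb] at this <;> exact this
  · simp only [TM.result, ofFrag, hT, Sum.elim_inl, Sum.elim_inr, Option.elim]

end FP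

/-- Deciding a language is computing a partial function without output strings, defined exactly on
the language. -/
theorem mem_P_iff {L : Language Bool} {b : Str → Bool} (hb : ∀ x, b x = true ↔ x ∈ L) :
    L ∈ P ↔ PF fun x : Fin 1 → Str => [b (x 0)] := by
  have hsize : ∀ x : Str, size ![x] = x.length := fun x => by simp [size]
  constructor
  · rintro ⟨M, p, h⟩
    refine (FP.isSome (F := fun x : Fin 1 → Str => if b (x 0) then some ![] else none)
      (n := 0) ⟨M, p, fun x => ?_⟩).congr fun x => by cases b (x 0) <;> simp
    obtain ⟨c, hc, h⟩ := h (x 0)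
    have e : ![x 0] = x := by funext i; fin_cases i; rfl
    rw [← hsize, e] at hc
    refine ⟨c, hc, ?_⟩
    rw [← hb, TM.Accepting, and_iff_right hc.2] at h
    simp only [TM.result, h]
    split_ifs
    · congr 1; funext j; exact j.elim0
    · rfl
  · intro h
    obtain ⟨M, p, h⟩ := FP.of_pf (n := 0) h (v := fun j => j.elim0) fun j => j.elim0
    refine ⟨M, p, fun x => ?_⟩
    obtain ⟨c, hc, h⟩ := h ![x]
    rw [hsize] at hc
    refine ⟨c, hc, ?_⟩
    rw [← hb, TM.Accepting, and_iff_right hc.2]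
    simp only [TM.result, Matrix.cons_val_zero] at h
    cases h1 : M.acc c.var <;> cases h2 : b x <;> simp [h1, h2] at h ⊢

/-! ### Nondeterministic machines -/

namespace NTM

theorem stepWith_none {N : NTM} (b : Bool) (v : N.σ) (S : N.K → Str) :
    N.stepWith b ⟨none, v, S⟩ = none := rfl

theorem stepWith_true {N : NTM} (l : N.Λ) (v : N.σ) (S : N.K → Str) :
    N.stepWith true ⟨some l, v, S⟩ = (N.alt l).map fun q => TM2.stepAux q v S := rfl

theorem follow_cons {N : NTM} (b : Bool) (w : Str) (c : N.toTM.Cfg) :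
    N.follow (b :: w) c = (N.stepWith b c).bind (N.follow w) := rfl

theorem follow_halted {N : NTM} {w : Str} {c c' : N.toTM.Cfg} (hc : c.l = none)
    (h : N.follow w c = some c') : w = [] ∧ c' = c := by
  obtain ⟨l, v, S⟩ := c
  obtain rfl : l = none := hc
  cases w with
  | nil => exact ⟨rfl, (Option.some.inj h).symm⟩
  | cons b w => simp [follow_cons, stepWith_none] at h

/-- From the configuration `c`, the computation is deterministic and halts after exactly `k` steps
in the configuration `c'`. -/
inductive Det (N : NTM) : ℕ → N.toTM.Cfg → N.toTM.Cfg → Prop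
  | refl (c : N.toTM.Cfg) : c.l = none → Det N 0 c c
  | head {k : ℕ} {c c₁ c' : N.toTM.Cfg} : N.stepWith false c = some c₁ →
      N.stepWith true c = none → Det N k c₁ c' → Det N (k + 1) c c'

namespace Det

variable {N : NTM} {k : ℕ} {c c' : N.toTM.Cfg}

theorem follow_replicate (h : Det N k c c') :
    N.follow (List.replicate k false) c = some c' ∧ c'.l = none := by
  induction h with
  | refl c hc => exact ⟨rfl, hc⟩
  | head h₁ h₂ _ ih => exact ⟨by rw [List.replicate_succ, follow_cons, h₁]; exact ih.1, ih.2⟩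

theorem length_le (h : Det N k c c') {w : Str} {d : N.toTM.Cfg} (hw : N.follow w c = some d) :
    w.length ≤ k := by
  induction h generalizing w with
  | refl c hc => simp [(follow_halted hc hw).1]
  | head h₁ h₂ _ ih =>
    rcases w with _ | ⟨_ | _, w⟩
    · simp
    · rw [follow_cons, h₁] at hw
      simpa using ih hw
    · simp [follow_cons, h₂] at hw

theorem eq_of_halted (h : Det N k c c') {w : Str} {d : N.toTM.Cfg} (hw : N.follow w c = some d)
    (hd : d.l = none) : w = List.replicate k false ∧ d = c' := by
  induction h generalizing w with
  | refl c hc => simpa using follow_halted hc hw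
  | @head k c c₁ c' h₁ h₂ _ ih =>
    rcases w with _ | ⟨_ | _, w⟩
    · obtain rfl : c = d := Option.some.inj hw
      obtain ⟨l, v, S⟩ := c
      obtain rfl : l = none := hd
      cases h₁
    · rw [follow_cons, h₁] at hw
      simpa [List.replicate_succ] using ih hw
    · simp [follow_cons, h₂] at hw

end Det

end NTM

theorem TM.isSome_result {m n : ℕ} {M : TM m n} {c : M.Cfg} :
    (M.result c).isSome = M.acc c.var := by
  rw [TM.result]; split_ifs with h <;> simp [h]

/-- A deterministic machine is a nondeterministic one without alternatives; its only halting path is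
the one with all choices `false`. -/
theorem P_subset_UP : P ⊆ UP := by
  rintro L ⟨M, p, h⟩
  let N : NTM := ⟨M, fun _ => none⟩
  have key : ∀ k c c', StepsTo (TM2.step M.prog) k c c' → c'.l = none → NTM.Det N k c c' := by
    intro k c c' h
    induction h with
    | refl c => exact fun hc => .refl (N := N) c hc
    | @head k c c₁ c' h _ ih =>
      intro hc'
      obtain ⟨_ | l, v, S⟩ := c
      · cases h
      · exact .head h rfl (ih hc')
  choose c hc hL using h
  have hk : ∀ x, ∃ k ≤ p.eval x.length, NTM.Det N k (M.init ![x]) (c x) := by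
    intro x
    obtain ⟨k, hk, hs⟩ := (hc x).stepsTo
    exact ⟨k, hk, key _ _ _ hs (hc x).2⟩
  choose k hk hdet using hk
  refine ⟨N, p, ?_, ?_, fun x => ?_⟩
  · rintro x w ⟨d, hd⟩
    exact ((hdet x).length_le hd).trans (hk x)
  · rintro x w w' ⟨d, hd, ha⟩ ⟨d', hd', ha'⟩
    rw [((hdet x).eq_of_halted hd ha.1).1, ((hdet x).eq_of_halted hd' ha'.1).1]
  · rw [← hL]
    constructor
    · intro h
      exact ⟨_, c x, (hdet x).follow_replicate.1, h⟩
    · rintro ⟨w, d, hd, ha⟩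
      obtain rfl := ((hdet x).eq_of_halted hd ha.1).2
      exact ha

/-! ### Verifying computation paths -/

section checker

variable (N : NTM)

/-- The embedding of a nondeterministic machine into the machine that checks its paths. -/
def NTM.checkEmb : Emb N.K N.Λ N.σ (Option N.K) N.Λ (N.σ × Option Bool) where
  stk := .some
  lab := id
  get := Prod.fst
  set := fun s v => (s, v.2)
  get_set := fun _ _ => rfl
  set_set := fun _ _ _ => rfl
  set_get := fun _ => rfl

/-- When the simulated machine halts, look whether all choices have been used. -/
def NTM.checkEnd : BStmt (Option N.K) N.Λ (N.σ × Option Bool) :=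
  .peek none (fun v o => (v.1, o)) .halt

/-- A machine that checks whether its second input is an accepting path of the nondeterministic
machine `N` on its first input. -/
def NTM.checker : TM 2 0 where
  K := Option N.K
  inp := ⟨![some (N.inp 0), none], by intro i j; fin_cases i <;> fin_cases j <;> simp⟩
  out := fun j => j.elim0
  Λ := N.Λ
  main := N.main
  σ := N.σ × Option Bool
  start := (N.start, none)
  acc := fun v => N.acc v.1 && v.2.isNone
  prog := fun l => .pop none (fun v o => (v.1, o)) <|
    .branch (fun v => v.2.isNone) (.load (fun v => (v.1, some true)) .halt) <|
    .branch (fun v => v.2 == some false) (N.checkEmb.stmt N.checkEnd (N.prog l)) <|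
    match N.alt l with
    | none => .load (fun v => (v.1, some true)) .halt
    | some q => N.checkEmb.stmt N.checkEnd q

theorem NTM.checker_init (x w : Str) : N.checker.init ![x, w] =
    ⟨some N.main, (N.start, none), PT.ocons w (N.toTM.init ![x]).stk⟩ := by
  simp only [TM.init]
  congr 1
  funext k
  rcases k with _ | k
  · rw [show (none : N.checker.K) = N.checker.inp 1 from rfl, N.checker.inp.injective.extend_apply]
    rfl
  · by_cases hk : k = N.inp 0
    · subst hk
      rw [show (some (N.inp 0) : N.checker.K) = N.checker.inp 0 from rfl,
        N.checker.inp.injective.extend_apply]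
      exact (N.inp.injective.extend_apply ![x] (fun _ => []) 0).symm
    · refine (extend_apply' ![x, w] (fun _ => []) (some k : N.checker.K) ?_).trans
        (extend_apply' (f := N.inp) ![x] (fun _ => []) k ?_).symm
      · rintro ⟨i, hi⟩
        fin_cases i
        · exact hk (Option.some.inj hi).symm
        · cases hi
      · rintro ⟨i, rfl⟩
        exact hk (by rw [Subsingleton.elim i 0])

/-- Every step consumes one letter of `w` and executes the chosen statement, which gives the time
bound. The additional memory ends as `none` only if the simulated machine halts when `w` is
exhausted: a premature end of `w`, an impossible choice and superfluous letters all leave some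
letter there. -/
theorem NTM.checker_stepsTo (w : Str) (l : N.Λ) (v : N.σ) (o : Option Bool) (S : N.K → Str) :
    ∃ k ≤ w.length + 1, ∃ c, StepsTo (TM2.step N.checker.prog) k
      ⟨some l, (v, o), PT.ocons w S⟩ c ∧ c.l = none ∧
      (N.checker.acc c.var = true ↔
        ∃ d, N.follow w ⟨some l, v, S⟩ = some d ∧ N.toTM.Accepting d) := by
  have hcfg : ∀ (w : Str) (o : Option Bool) (v : N.σ) (S : N.K → Str) (d : N.toTM.Cfg),
      N.checkEmb.cfg N.checkEnd (v, o) (PT.ocons w S) d = match d.l with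
        | some l => ⟨some l, (d.var, o), PT.ocons w d.stk⟩
        | none => ⟨none, (d.var, w.head?), PT.ocons w d.stk⟩ := by
    rintro w o v S ⟨l, v', S'⟩
    have e : extend (Embedding.some : N.K ↪ Option N.K) S' (PT.ocons w S) = PT.ocons w S' :=
      Emb.eq_extend _ rfl (by rintro (_ | k) hk; · rfl
                              · exact absurd ⟨k, rfl⟩ hk)
    cases l <;> simp only [Emb.cfg, checkEmb, checkEnd, TM2.stepAux, e] <;> rfl
  have hupd : ∀ (b : Bool) (w : Str) (S : N.K → Str),
      update (PT.ocons (b :: w) S) none w = PT.ocons w S := by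
    intro b w S; funext k; cases k <;> simp [PT.ocons]
  have hacc : ∀ (v : N.σ) o, N.checker.acc (v, o) = (N.acc v && o.isNone) := fun _ _ => rfl
  induction w generalizing l v o S with
  | nil =>
    refine ⟨1, by simp, ⟨none, (v, some true), update (PT.ocons [] S) none []⟩, .single rfl, rfl, ?_⟩
    simp only [hacc, Option.isNone_some, Bool.and_false, Bool.false_eq_true, false_iff]
    rintro ⟨d, hd, ha⟩
    obtain rfl := Option.some.inj hd
    cases ha.1
  | cons b w ih =>
    have main : ∀ q : BStmt N.K N.Λ N.σ,
        N.stepWith b ⟨some l, v, S⟩ = some (TM2.stepAux q v S) →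
        TM2.stepAux (N.checker.prog l) (v, o) (PT.ocons (b :: w) S) =
          TM2.stepAux (N.checkEmb.stmt N.checkEnd q) (v, some b) (PT.ocons w S) →
        ∃ k ≤ (b :: w).length + 1, ∃ c, StepsTo (TM2.step N.checker.prog) k
          ⟨some l, (v, o), PT.ocons (b :: w) S⟩ c ∧ c.l = none ∧
          (N.checker.acc c.var = true ↔
            ∃ d, N.follow (b :: w) ⟨some l, v, S⟩ = some d ∧ N.toTM.Accepting d) := by
      intro q hq hq'
      have e : TM2.stepAux q (N.checkEmb.get (v, some b)) (PT.ocons w S ∘ N.checkEmb.stk) =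
        TM2.stepAux q v S := rfl
      rw [Emb.stepAux_stmt, e, hcfg] at hq'
      rw [NTM.follow_cons, hq, Option.bind_some]
      generalize TM2.stepAux q v S = d at hq' ⊢
      obtain ⟨_ | l', v', S'⟩ := d
      · refine ⟨1, by simp, _, .single (congrArg some hq'), rfl, ?_⟩
        simp only [hacc, Bool.and_eq_true, Option.isNone_iff_eq_none, List.head?_eq_none_iff]
        constructor
        · rintro ⟨h1, rfl⟩
          exact ⟨_, rfl, rfl, h1⟩
        · rintro ⟨d, hd, ha⟩
          obtain ⟨rfl, rfl⟩ := NTM.follow_halted rfl hd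
          exact ⟨ha.2, rfl⟩
      · obtain ⟨k, hk, c, hc, hl, hiff⟩ := ih l' v' (some b) S'
        exact ⟨k + 1, by simpa using hk, c, .head (congrArg some hq') hc, hl, hiff⟩
    cases b with
    | false =>
      refine main (N.prog l) rfl ?_
      simp only [checker, TM2.stepAux]
      erw [hupd]
      rfl
    | true =>
      cases halt : N.alt l with
      | some q =>
        refine main q (by rw [NTM.stepWith_true, halt]; rfl) ?_
        simp only [checker, TM2.stepAux, halt]
        erw [hupd]
        rfl
      | none =>
        refine ⟨1, by simp, ⟨none, (v, some true), update (PT.ocons (true :: w) S) none w⟩,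
          .single ?_, rfl, ?_⟩
        · simp only [TM2.step, checker, TM2.stepAux, halt]
          rfl
        · simp [hacc, NTM.follow_cons, NTM.stepWith_true, halt]

/-- Accepting paths are recognized in polynomial time. -/
theorem NTM.exists_pf_isAcceptingPath : ∃ V : Str → Str → Bool,
    (∀ x w, V x w = true ↔ N.IsAcceptingPath x w) ∧
    PF fun v : Fin 2 → Str => [V (v 0) (v 1)] := by
  have h : ∀ v : Fin 2 → Str, ∃ c, N.checker.HaltsWithin v (size v + 1) c ∧
      (N.checker.acc c.var = true ↔ N.IsAcceptingPath (v 0) (v 1)) := by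
    intro v
    obtain ⟨k, hk, c, hc, hl, hiff⟩ :=
      N.checker_stepsTo (v 1) N.main N.start none (N.toTM.init ![v 0]).stk
    have e : v = ![v 0, v 1] := by funext i; fin_cases i <;> rfl
    refine ⟨c, ⟨StepsTo.nonempty_evalsToInTime_iff.2 ⟨k, hk.trans ?_, ?_⟩, hl⟩, hiff⟩
    · simp [size]
    · conv => arg 3; rw [e]
      rw [NTM.checker_init]
      exact hc
  choose c hc hiff using h
  have hpf := FP.isSome (F := fun v => N.checker.result (c v)) (n := 0)
    ⟨N.checker, Polynomial.X + 1, fun v => ⟨c v, by simpa using hc v, rfl⟩⟩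
  refine ⟨fun x w => N.checker.acc (c ![x, w]).var, fun x w => by rw [hiff]; rfl,
    hpf.congr fun v => ?_⟩
  have e : v = ![v 0, v 1] := by funext i; fin_cases i <;> rfl
  rw [TM.isSome_result]
  conv => lhs; rw [e]

end checker

theorem PF.reverse {ι : Type} [Fintype ι] [DecidableEq ι] {f : (ι → Str) → Str} (hf : PF f) :
    PF fun S => (f S).reverse := by
  refine ((PT.moveReverse (κ := Unit)).pf (f := fun o S => o.elim (f S) fun _ => [])
    (fun o => ?_) (fun _ => trivial) (some ())).congr fun S => by simp [PT.ocons]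
  cases o
  · exact hf
  · exact PF.nil

/-! ### Guessing a witness -/

section guesser

variable (M : TM 2 0)

/-- The embedding of the verifying machine. -/
def guessEmb : Emb M.K M.Λ M.σ (Option M.K) (Option M.Λ) (M.σ × Option Bool) where
  stk := .some
  lab := some
  get := Prod.fst
  set := fun s v => (s, v.2)
  get_set := fun _ _ => rfl
  set_set := fun _ _ _ => rfl
  set_get := fun _ => rfl

/-- Move a letter of the input to the verifying machine, and guess the letter `g` of the witness.
At the end of the input, only the guess `false` is permitted. -/
def guessStmt (g : Bool) : BStmt (Option M.K) (Option M.Λ) (M.σ × Option Bool) :=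
  .pop none (fun v o => (v.1, o)) <|
  .branch (fun v => v.2.isNone)
    (cond g (.load (fun v => (v.1, some true)) .halt) (.goto fun _ => some M.main)) <|
  .push (some (M.inp 0)) (fun v => v.2.getD false) <|
  .push (some (M.inp 1)) (fun _ => g) <|
  .goto fun _ => none

/-- A nondeterministic machine that guesses a witness as long as the input, and then executes the
machine `M` on the reversed input and the reversed witness. -/
def guesser : NTM where
  K := Option M.K
  inp := ⟨fun _ => none, fun i j _ => Subsingleton.elim i j⟩
  out := fun j => j.elim0
  Λ := Option M.Λ
  main := none
  σ := M.σ × Option Bool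
  start := (M.start, none)
  acc := fun v => M.acc v.1 && v.2.isNone
  prog := fun l => l.elim (guessStmt M false) fun l => (guessEmb M).stmt .halt (M.prog l)
  alt := fun l => l.elim (some (guessStmt M true)) fun _ => none

variable {M}

/-- Once the guessing is over there are no alternatives any more, so each run of `M` contributes a
single halting path. -/
theorem guesser_det {k : ℕ} {l : Option M.Λ} {v : M.σ} {S : M.K → Str} {c : M.Cfg}
    (h : StepsTo (TM2.step M.prog) k ⟨l, v, S⟩ c) (hc : c.l = none) (o : Option Bool) :
    NTM.Det (guesser M) k ⟨l.map some, (v, o), PT.ocons [] S⟩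
      ⟨none, (c.var, o), PT.ocons [] c.stk⟩ := by
  induction k generalizing l v S with
  | zero => cases h; obtain rfl : l = none := hc; exact .refl (N := guesser M) _ rfl
  | succ k ih =>
    rcases h with _ | ⟨hb, hrest⟩
    obtain _ | l := l
    · cases hb
    · rename_i b
      obtain ⟨lb, vb, Sb⟩ := b
      refine .head (N := guesser M) ?_ rfl (ih hrest)
      have e : TM2.stepAux (M.prog l) ((guessEmb M).get (v, o))
        (PT.ocons [] S ∘ (guessEmb M).stk) = ⟨lb, vb, Sb⟩ := Option.some.inj hb
      have e2 : extend (Embedding.some : M.K ↪ Option M.K) Sb (PT.ocons [] S) = PT.ocons [] Sb :=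
        Emb.eq_extend _ rfl (by rintro (_ | k) hk; · rfl
                                · exact absurd ⟨k, rfl⟩ hk)
      have e3 := Emb.stepAux_stmt (guessEmb M) .halt (M.prog l) (v, o) (PT.ocons [] S)
      rw [e] at e3
      refine congrArg some (e3.trans ?_)
      cases lb <;> simp only [Emb.cfg, guessEmb, e2, TM2.stepAux] <;> rfl

/-- The stacks of the verifying machine, with `y` and `u` on its input stacks. -/
noncomputable def verifierStk (M : TM 2 0) (y u : Str) : M.K → Str := (M.init ![y, u]).stk

theorem guesser_init (x : Str) : (guesser M).toTM.init ![x] =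
    ⟨some none, (M.start, none), PT.ocons x (verifierStk M [] [])⟩ := by
  simp only [TM.init]
  congr 1
  funext k
  rcases k with _ | k
  · exact (guesser M).inp.injective.extend_apply ![x] (fun _ => []) 0
  · refine (extend_apply' ![x] (fun _ => []) (some k : (guesser M).K) ?_).trans ?_
    · rintro ⟨i, hi⟩
      cases hi
    · change [] = extend M.inp ![[], []] (fun _ => []) k
      by_cases hk : ∃ i, M.inp i = k
      · obtain ⟨i, rfl⟩ := hk
        rw [M.inp.injective.extend_apply]
        fin_cases i <;> rfl
      · rw [extend_apply' _ _ _ hk]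

theorem verifierStk_inp (y u : Str) (i : Fin 2) : verifierStk M y u (M.inp i) = ![y, u] i :=
  M.inp.injective.extend_apply ![y, u] (fun _ => []) i

theorem update_verifierStk (y u : Str) (a g : Bool) :
    update (update (verifierStk M y u) (M.inp 0) (a :: y)) (M.inp 1) (g :: u) =
      verifierStk M (a :: y) (g :: u) := by
  funext k
  by_cases hk : ∃ i, M.inp i = k
  · obtain ⟨i, rfl⟩ := hk
    rw [verifierStk_inp]
    fin_cases i <;> simp
  · have h : ∀ y u, verifierStk M y u k = [] := fun y u =>
      extend_apply' ![y, u] (fun _ => []) k hk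
    rw [h, update_of_ne (fun e => hk ⟨1, e.symm⟩), update_of_ne (fun e => hk ⟨0, e.symm⟩), h]

theorem stepWith_guess_cons (g a : Bool) (x y u : Str) (s : M.σ) (o : Option Bool) :
    (guesser M).stepWith g ⟨some none, (s, o), PT.ocons (a :: x) (verifierStk M y u)⟩ =
      some ⟨some none, (s, some a), PT.ocons x (verifierStk M (a :: y) (g :: u))⟩ := by
  have e : TM2.stepAux (guessStmt M g) (s, o) (PT.ocons (a :: x) (verifierStk M y u)) =
      ⟨some none, (s, some a), PT.ocons x (verifierStk M (a :: y) (g :: u))⟩ := by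
    rw [← update_verifierStk]
    simp only [guessStmt, TM2.stepAux, PT.ocons, Option.elim, List.head?_cons, Option.isNone_some,
      cond_false, Option.getD_some, List.tail_cons]
    congr 1
    have h0 := verifierStk_inp (M := M) y u 0
    have h1 := verifierStk_inp (M := M) y u 1
    funext k
    rcases k with _ | k
    · simp [PT.ocons]
    · simp [update_apply, PT.ocons, h0, h1]
  cases g
  · exact congrArg some e
  · exact congrArg some e

/-- The computation paths of the guessing machine. -/
theorem guesser_follow (c : Str → Str → M.Cfg) (k : Str → Str → ℕ)
    (h : ∀ y u, StepsTo (TM2.step M.prog) (k y u) (M.init ![y, u]) (c y u))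
    (hc : ∀ y u, (c y u).l = none) (x y v : Str) (o : Option Bool) :
    (∀ w d, (guesser M).follow w ⟨some none, (M.start, o), PT.ocons x (verifierStk M y v)⟩ =
        some d → ∃ u, w.length ≤ x.length + 1 + k (x.reverse ++ y) (u ++ v) ∧
          u.length = x.length) ∧
    (∀ w, (∃ d, (guesser M).follow w ⟨some none, (M.start, o), PT.ocons x (verifierStk M y v)⟩ =
        some d ∧ (guesser M).toTM.Accepting d) ↔
      ∃ u, u.length = x.length ∧ M.acc (c (x.reverse ++ y) (u.reverse ++ v)).var = true ∧
        w = u ++ false :: List.replicate (k (x.reverse ++ y) (u.reverse ++ v)) false) := by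
  induction x generalizing y v o with
  | nil =>
    -- The input is exhausted: the choice `false` starts `M`, whereas `true` leads to immediate
    -- rejection. This step must not double the number of accepting paths.
    have hs : (guesser M).stepWith false
        ⟨some none, (M.start, o), PT.ocons [] (verifierStk M y v)⟩ =
        some ⟨some (some M.main), (M.start, none), PT.ocons [] (verifierStk M y v)⟩ := by
      refine congrArg some ?_
      have e : update (PT.ocons [] (verifierStk M y v)) none [] =
        PT.ocons [] (verifierStk M y v) := by funext k; cases k <;> simp [PT.ocons]
      have : TM2.stepAux (guessStmt M false) (M.start, o) (PT.ocons [] (verifierStk M y v)) =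
          ⟨some (some M.main), (M.start, none),
            update (PT.ocons [] (verifierStk M y v)) none []⟩ := rfl
      rw [e] at this
      exact this
    have ht : (guesser M).stepWith true
        ⟨some none, (M.start, o), PT.ocons [] (verifierStk M y v)⟩ =
        some ⟨none, (M.start, some true),
          update (PT.ocons [] (verifierStk M y v)) none []⟩ := rfl
    have hdet := guesser_det (h y v) (hc y v) none
    refine ⟨fun w d hd => ⟨[], ?_, rfl⟩, fun w => ?_⟩
    · simp only [List.length_nil, List.reverse_nil, List.nil_append]
      rcases w with _ | ⟨_ | _, w⟩
      · simp
      · rw [NTM.follow_cons, hs, Option.bind_some] at hd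
        have := hdet.length_le hd
        simp only [List.length_cons]
        omega
      · rw [NTM.follow_cons, ht, Option.bind_some] at hd
        simp [(NTM.follow_halted rfl hd).1]
    · simp only [List.length_nil, List.reverse_nil, List.nil_append, List.length_eq_zero_iff]
      constructor
      · rintro ⟨d, hd, ha⟩
        rcases w with _ | ⟨_ | _, w⟩
        · obtain rfl := Option.some.inj hd
          cases ha.1
        · rw [NTM.follow_cons, hs, Option.bind_some] at hd
          obtain ⟨rfl, rfl⟩ := hdet.eq_of_halted hd ha.1
          exact ⟨[], rfl, by simpa [guesser] using ha.2, rfl⟩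
        · rw [NTM.follow_cons, ht, Option.bind_some] at hd
          obtain ⟨rfl, rfl⟩ := NTM.follow_halted rfl hd
          simp [TM.Accepting, guesser] at ha
      · rintro ⟨u, rfl, ha, rfl⟩
        refine ⟨⟨none, ((c y v).var, none), PT.ocons [] (c y v).stk⟩, ?_, rfl, ?_⟩
        · exact (congrArg (fun o => Option.bind o _) hs).trans hdet.follow_replicate.1
        · simpa [guesser] using ha
  | cons a x ih =>
    have hs := fun g => stepWith_guess_cons (M := M) g a x y v M.start o
    refine ⟨fun w d hd => ?_, fun w => ?_⟩
    · rcases w with _ | ⟨g, w⟩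
      · exact ⟨a :: x, by simp, rfl⟩
      · rw [NTM.follow_cons, hs, Option.bind_some] at hd
        obtain ⟨u, hu, hl⟩ := (ih (a :: y) (g :: v) (some a)).1 w d hd
        refine ⟨u ++ [g], ?_, by simp [hl]⟩
        simp only [List.length_cons, List.reverse_cons, List.append_assoc, List.singleton_append]
        omega
    · constructor
      · rintro ⟨d, hd, ha⟩
        rcases w with _ | ⟨g, w⟩
        · obtain rfl := Option.some.inj hd
          cases ha.1
        · rw [NTM.follow_cons, hs, Option.bind_some] at hd
          obtain ⟨u, hu, hacc, rfl⟩ := ((ih (a :: y) (g :: v) (some a)).2 w).1 ⟨d, hd, ha⟩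
          exact ⟨g :: u, by simp [hu], by simpa using hacc, by simp⟩
      · rintro ⟨u, hu, hacc, rfl⟩
        rcases u with _ | ⟨g, u⟩
        · simp at hu
        · obtain ⟨d, hd, ha⟩ := ((ih (a :: y) (g :: v) (some a)).2 _).2
            ⟨u, by simpa using hu, by simpa using hacc, rfl⟩
          refine ⟨d, ?_, ha⟩
          rw [List.cons_append, NTM.follow_cons, hs, Option.bind_some]
          simpa using hd

end guesser

/-- Languages defined by the existence of a unique witness that is as long as the input are in
`UP`. -/
theorem mem_UP_of_unique {R : Str → Str → Bool} (hR : PF fun v : Fin 2 → Str => [R (v 0) (v 1)])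
    (huniq : ∀ x u u', u.length = x.length → u'.length = x.length → R x u = true →
      R x u' = true → u = u') :
    ({x | ∃ u, u.length = x.length ∧ R x u = true} : Set Str) ∈ UP := by
  -- The guessing machine transfers both strings letter by letter and thereby reverses them; testing
  -- the relation on reversed strings compensates for this.
  have hR' : PF fun v : Fin 2 → Str => [R (v 0).reverse (v 1).reverse] :=
    (hR.comp (f := fun i S => (S i).reverse) fun i => (PF.proj i).reverse)
  obtain ⟨M, p, h⟩ := FP.of_pf (n := 0) hR' (v := fun j => j.elim0) fun j => j.elim0
  choose c₀ hc hres using h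
  have hacc : ∀ y u, M.acc (c₀ ![y, u]).var = R y.reverse u.reverse := by
    intro y u
    rw [← TM.isSome_result, hres]
    cases h : R y.reverse u.reverse <;> simp [h]
  choose k hk hs using fun x => (hc x).stepsTo
  have key := guesser_follow (fun y u => c₀ ![y, u]) (fun y u => k ![y, u]) (fun y u => hs _)
    fun y u => (hc _).2
  have hpath : ∀ x w, (guesser M).IsAcceptingPath x w ↔ ∃ u, u.length = x.length ∧
      R x u = true ∧ w = u ++ false :: List.replicate (k ![x.reverse, u.reverse]) false := by
    intro x w
    rw [NTM.IsAcceptingPath, guesser_init, (key x [] [] none).2]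
    simp [hacc]
  -- There are as many guesses as letters in the input, one step that starts `M`, and the run of `M`
  -- on two strings of total length `2 * x.length`.
  refine ⟨guesser M, Polynomial.X + 1 + p.comp (2 * Polynomial.X), ?_, ?_, fun x => ?_⟩
  · rintro x w ⟨d, hd⟩
    rw [guesser_init] at hd
    obtain ⟨u, hu, hl⟩ := (key x [] [] none).1 w d hd
    refine hu.trans ?_
    simp only [List.append_nil, Polynomial.eval_add, Polynomial.eval_X, Polynomial.eval_one,
      Polynomial.eval_comp, Polynomial.eval_mul, Polynomial.eval_ofNat]
    refine Nat.add_le_add_left ((hk _).trans (eval_mono _ ?_)) _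
    simp [size, hl]
    omega
  · intro x w w' h h'
    obtain ⟨u, hu, hRu, rfl⟩ := (hpath x w).1 h
    obtain ⟨u', hu', hRu', rfl⟩ := (hpath x w').1 h'
    rw [huniq x u u' hu hu' hRu hRu']
  · constructor
    · rintro ⟨u, hu, hRu⟩
      exact ⟨_, (hpath x _).2 ⟨u, hu, hRu, rfl⟩⟩
    · rintro ⟨w, hw⟩
      obtain ⟨u, hu, hRu, -⟩ := (hpath x w).1 hw
      exact ⟨u, hu, hRu⟩

/-! ### Polynomial-time tests -/

section tests

variable {ι : Type} [Fintype ι] [DecidableEq ι] {f g : (ι → Str) → Str} {b c : (ι → Str) → Bool}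

theorem PF.ite (hb : PF fun S => [b S]) (hf : PF f) (hg : PF g) :
    PF fun S => if b S = true then f S else g S := by
  refine (hb.case (f := fun o S => if o = some true then f S else g S) fun o => ?_).congr
    fun S => by simp
  by_cases ho : o = some true
  · simpa [ho] using hf
  · simpa [ho] using hg

theorem PF.and (hb : PF fun S => [b S]) (hc : PF fun S => [c S]) : PF fun S => [b S && c S] :=
  (hb.ite hc (PF.const [false])).congr fun S => by cases b S <;> simp

theorem PF.or (hb : PF fun S => [b S]) (hc : PF fun S => [c S]) : PF fun S => [b S || c S] :=
  (hb.ite (PF.const [true]) hc).congr fun S => by cases b S <;> simp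

theorem PF.not (hb : PF fun S => [b S]) : PF fun S => [!b S] :=
  (hb.ite (PF.const [false]) (PF.const [true])).congr fun S => by cases b S <;> simp

theorem PF.head?_eq (hf : PF f) (o : Option Bool) : PF fun S => [(f S).head? == o] :=
  hf.case (f := fun o' _ => [o' == o]) fun _ => PF.const _

theorem PF.comp₂ {h : Str → Str → Str} (hh : PF fun v : Fin 2 → Str => h (v 0) (v 1)) (hf : PF f)
    (hg : PF g) : PF fun S => h (f S) (g S) :=
  PF.comp hh (f := ![f, g]) fun i => by fin_cases i; exacts [hf, hg]

theorem PF.comp₁ {h : Str → Str} (hh : PF fun v : Fin 1 → Str => h (v 0)) (hf : PF f) :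
    PF fun S => h (f S) :=
  PF.comp hh (f := fun _ => f) fun _ => hf

end tests

theorem polyTimeComputable_ite {c : Str → Str → Bool} {g : Str → Str → Str}
    (hc : PF fun v : Fin 2 → Str => [c (v 0) (v 1)])
    (hg : PF fun v : Fin 2 → Str => g (v 0) (v 1)) :
    PolyTimeComputable fun x y => if c x y = true then some (g x y) else none := by
  have := FP.of_pf (n := 1) hc (v := fun _ v => g (v 0) (v 1)) fun _ => hg
  unfold PolyTimeComputable
  convert this using 2 with v
  by_cases h : c (v 0) (v 1) = true
  · simp only [h, if_true, Option.map_some, Option.some.injEq]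
    funext j; fin_cases j; rfl
  · simp only [h]
    rfl

/-! ### One-way functions from languages with unique witnesses -/

/-- The test for pairs `(10x, 11w)` such that `V x w` holds. -/
def tagged (V : Str → Str → Bool) (a b : Str) : Bool :=
  (a.head? == some true && a.tail.head? == some false) &&
    ((b.head? == some true && b.tail.head? == some true) && V a.tail.tail b.tail.tail)

/-- The function with `(10x, 11w) ↦ 0x` for all pairs such that `V x w` holds. -/
def orderedFn (V : Str → Str → Bool) (a b : Str) : Option Str :=
  if tagged V a b = true then some (false :: a.tail.tail) else none

/-- The commutative function with `(10x, 11w) ↦ 0x` for all pairs such that `V x w` holds. -/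
def unorderedFn (V : Str → Str → Bool) (a b : Str) : Option Str :=
  if (tagged V a b || tagged V b a) = true then
    some (if tagged V a b = true then false :: a.tail.tail else false :: b.tail.tail) else none

section witness

variable {V : Str → Str → Bool}

theorem tagged_iff {a b : Str} : tagged V a b = true ↔
    ∃ x w, a = true :: false :: x ∧ b = true :: true :: w ∧ V x w = true := by
  rcases a with _ | ⟨_ | _, _ | ⟨_ | _, a⟩⟩ <;> rcases b with _ | ⟨_ | _, _ | ⟨_ | _, b⟩⟩ <;>
    simp [tagged]

theorem orderedFn_eq_some {a b z : Str} : orderedFn V a b = some z ↔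
    ∃ x w, a = true :: false :: x ∧ b = true :: true :: w ∧ V x w = true ∧ z = false :: x := by
  rw [orderedFn, Option.ite_none_right_eq_some, tagged_iff]
  constructor
  · rintro ⟨⟨x, w, rfl, rfl, h⟩, hz⟩
    exact ⟨x, w, rfl, rfl, h, (Option.some.inj hz).symm⟩
  · rintro ⟨x, w, rfl, rfl, h, rfl⟩
    exact ⟨⟨x, w, rfl, rfl, h⟩, rfl⟩

theorem unorderedFn_eq_some {a b z : Str} : unorderedFn V a b = some z ↔
    orderedFn V a b = some z ∨ orderedFn V b a = some z := by
  -- The tags `10` and `11` are different, so at most one order of the arguments is admissible.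
  have hex : ∀ {a b}, tagged V a b = true → tagged V b a = true → False := by
    intro a b h h'
    obtain ⟨x, w, rfl, rfl, -⟩ := tagged_iff.1 h
    obtain ⟨x, w, h, -, -⟩ := tagged_iff.1 h'
    simp at h
  simp only [unorderedFn, orderedFn]
  by_cases h : tagged V a b = true <;> by_cases h' : tagged V b a = true
  · exact (hex h h').elim
  · simp [h, h']
  · simp [h, h']
  · simp [h, h']

theorem orderedFn_false_left (x b : Str) : orderedFn V (false :: x) b = none := by
  simp [orderedFn, tagged]

theorem orderedFn_false_right (x a : Str) : orderedFn V a (false :: x) = none := by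
  simp [orderedFn, tagged]

/-- A value of `f` never occurs as an argument in the domain, so both sides of the associative law
are undefined. -/
theorem associative_of_range {f : Str → Str → Option Str}
    (h : ∀ a b z, f a b = some z → ∀ c, f z c = none ∧ f c z = none) : Associative f := by
  intro x y z
  have h1 : extension f (extension f (some x) (some y)) (some z) = none := by
    change extension f (f x y) (some z) = none
    cases hxy : f x y with
    | none => rfl
    | some u => exact (h _ _ _ hxy z).1
  have h2 : extension f (some x) (extension f (some y) (some z)) = none := by
    change extension f (some x) (f y z) = none
    cases hyz : f y z with
    | none => rfl
    | some u => exact (h _ _ _ hyz x).2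
  rw [h1, h2]

theorem associative_orderedFn : Associative (orderedFn V) := by
  refine associative_of_range fun a b z h c => ?_
  obtain ⟨x, w, -, -, -, rfl⟩ := orderedFn_eq_some.1 h
  exact ⟨orderedFn_false_left x c, orderedFn_false_right x c⟩

theorem associative_unorderedFn : Associative (unorderedFn V) := by
  refine associative_of_range fun a b z h c => ?_
  have hz : ∃ x, z = false :: x := by
    rcases unorderedFn_eq_some.1 h with h | h <;>
    · obtain ⟨x, w, -, -, -, rfl⟩ := orderedFn_eq_some.1 h
      exact ⟨x, rfl⟩
  obtain ⟨x, rfl⟩ := hz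
  constructor <;> rw [Option.eq_none_iff_forall_ne_some] <;> intro y hy <;>
    rw [unorderedFn_eq_some, orderedFn_false_left, orderedFn_false_right] at hy <;> simp at hy

theorem unorderedFn_comm (a b : Str) : unorderedFn V a b = unorderedFn V b a :=
  Option.ext fun z => by
    rw [unorderedFn_eq_some, unorderedFn_eq_some, or_comm]

theorem pf_tagged (hV : PF fun v : Fin 2 → Str => [V (v 0) (v 1)]) :
    PF fun v : Fin 2 → Str => [tagged V (v 0) (v 1)] :=
  (((PF.proj 0).head?_eq _).and ((PF.proj 0).tail.head?_eq _)).and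
    ((((PF.proj 1).head?_eq _).and ((PF.proj 1).tail.head?_eq _)).and
      (PF.comp₂ (h := fun x w => [V x w]) hV (PF.proj 0).tail.tail (PF.proj 1).tail.tail))

theorem polyTimeComputable_orderedFn (hV : PF fun v : Fin 2 → Str => [V (v 0) (v 1)]) :
    PolyTimeComputable (orderedFn V) :=
  polyTimeComputable_ite (pf_tagged hV) (g := fun a _ => false :: a.tail.tail)
    ((PF.proj 0).tail.tail.cons false)

theorem polyTimeComputable_unorderedFn (hV : PF fun v : Fin 2 → Str => [V (v 0) (v 1)]) :
    PolyTimeComputable (unorderedFn V) := by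
  have h := pf_tagged hV
  have h' : PF fun v : Fin 2 → Str => [tagged V (v 1) (v 0)] :=
    PF.comp₂ (h := fun x w => [tagged V x w]) h (PF.proj 1) (PF.proj 0)
  exact polyTimeComputable_ite (c := fun a b => tagged V a b || tagged V b a) (h.or h')
    (g := fun a b => if tagged V a b = true then false :: a.tail.tail else false :: b.tail.tail)
    (h.ite ((PF.proj 0).tail.tail.cons false) ((PF.proj 1).tail.tail.cons false))

variable {L : Language Bool}

/-- The candidate `h x` is checked with `V`, so its value is irrelevant for `x ∉ L`. -/
theorem mem_P_of_witness (hV : PF fun v : Fin 2 → Str => [V (v 0) (v 1)])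
    (hL : ∀ x, x ∈ L ↔ ∃ w, V x w = true)
    {h : Str → Str} (hh : PF fun v : Fin 1 → Str => h (v 0))
    (hw : ∀ x w, V x w = true → V x (h x) = true) : L ∈ P := by
  refine (mem_P_iff (b := fun x => V x (h x)) fun x => ?_).2 ?_
  · rw [hL]
    exact ⟨fun h => ⟨_, h⟩, fun ⟨w, h⟩ => hw x w h⟩
  · exact PF.comp₂ (h := fun x w => [V x w]) hV (PF.proj 0) hh

theorem mem_P_of_fpInvertible_orderedFn (hV : PF fun v : Fin 2 → Str => [V (v 0) (v 1)])
    (hL : ∀ x, x ∈ L ↔ ∃ w, V x w = true)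
    (h : FPInvertible (orderedFn V)) : L ∈ P := by
  obtain ⟨g, hg, h⟩ := h
  have hg1 : PF fun v : Fin 1 → Str => (g (v 0)).2 := FP.value hg 1
  refine mem_P_of_witness hV hL (h := fun x => (g (false :: x)).2.tail.tail) ?_ fun x w hw => ?_
  · exact (PF.comp₁ (h := fun x => (g x).2) hg1 ((PF.proj 0).cons false)).tail.tail
  · have := h (false :: x) ⟨_, _, orderedFn_eq_some.2 ⟨x, w, rfl, rfl, hw, rfl⟩⟩
    obtain ⟨x', w', -, hb, hw', hx⟩ := orderedFn_eq_some.1 this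
    obtain rfl : x = x' := by simpa using hx
    rwa [hb]

theorem mem_P_of_fpInvertible_unorderedFn (hV : PF fun v : Fin 2 → Str => [V (v 0) (v 1)])
    (hL : ∀ x, x ∈ L ↔ ∃ w, V x w = true)
    (h : FPInvertible (unorderedFn V)) : L ∈ P := by
  obtain ⟨g, hg, h⟩ := h
  have hg0 : PF fun v : Fin 1 → Str => (g (v 0)).1 := FP.value hg 0
  have hg1 : PF fun v : Fin 1 → Str => (g (v 0)).2 := FP.value hg 1
  have hg0' : PF fun v : Fin 1 → Str => (g (false :: v 0)).1.tail.tail :=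
    (PF.comp₁ (h := fun x => (g x).1) hg0 ((PF.proj 0).cons false)).tail.tail
  have hg1' : PF fun v : Fin 1 → Str => (g (false :: v 0)).2.tail.tail :=
    (PF.comp₁ (h := fun x => (g x).2) hg1 ((PF.proj 0).cons false)).tail.tail
  -- The inverse may return the two arguments in either order. Hence the first component is tried as
  -- a witness, and the second one is taken if this fails.
  refine mem_P_of_witness hV hL (h := fun x => if V x (g (false :: x)).1.tail.tail = true
    then (g (false :: x)).1.tail.tail else (g (false :: x)).2.tail.tail) ?_ fun x w hw => ?_
  · exact (PF.comp₂ (h := fun x w => [V x w]) hV (PF.proj 0) hg0').ite hg0' hg1'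
  · have := h (false :: x) ⟨_, _, unorderedFn_eq_some.2
      (.inl (orderedFn_eq_some.2 ⟨x, w, rfl, rfl, hw, rfl⟩))⟩
    split_ifs with hc
    · exact hc
    · rcases unorderedFn_eq_some.1 this with this | this
      · obtain ⟨x', w', -, hb, hw', hx⟩ := orderedFn_eq_some.1 this
        obtain rfl : x = x' := by simpa using hx
        rwa [hb]
      · obtain ⟨x', w', -, hb, hw', hx⟩ := orderedFn_eq_some.1 this
        obtain rfl : x = x' := by simpa using hx
        rw [hb] at hc
        exact absurd hw' hc

theorem strong_unorderedFn (hV : PF fun v : Fin 2 → Str => [V (v 0) (v 1)])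
    (hL : ∀ x, x ∈ L ↔ ∃ w, V x w = true)
    (hLP : L ∉ P) : Strong (unorderedFn V) := by
  have key : ¬ ∃ g : Str → Str → Str,
      (fun v : Fin 2 → Str => some ![g (v 0) (v 1)]) ∈ FP 2 1 ∧
      ∀ z x, (∃ y, unorderedFn V x y = some z) → unorderedFn V x (g x z) = some z := by
    rintro ⟨g, hg, h⟩
    have hg0 : PF fun v : Fin 2 → Str => g (v 0) (v 1) := FP.value hg 0
    -- The given argument `10x` and the value `0x` can be formed from `x` alone. The tag `10` on the
    -- left forces the missing argument to be `11w`.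
    refine hLP (mem_P_of_witness hV hL
      (h := fun x => (g (true :: false :: x) (false :: x)).tail.tail) ?_ fun x w hw => ?_)
    · exact (PF.comp₂ hg0 (((PF.proj 0).cons false).cons true)
        ((PF.proj 0).cons false)).tail.tail
    · have := h (false :: x) (true :: false :: x) ⟨_, unorderedFn_eq_some.2
        (.inl (orderedFn_eq_some.2 ⟨x, w, rfl, rfl, hw, rfl⟩))⟩
      rcases unorderedFn_eq_some.1 this with this | this
      · obtain ⟨x', w', -, hb, hw', hx⟩ := orderedFn_eq_some.1 this
        obtain rfl : x = x' := by simpa using hx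
        rwa [hb]
      · obtain ⟨x', w', -, hb, -, -⟩ := orderedFn_eq_some.1 this
        simp at hb
  -- By commutativity, an inverter for a given second argument is one for a given first argument.
  refine ⟨key, fun ⟨g, hg, h⟩ => key ⟨g, hg, fun z x ⟨y, hy⟩ => ?_⟩⟩
  rw [unorderedFn_comm] at hy ⊢
  exact h z x ⟨y, hy⟩

end witness

/-! ### The one-way functions that exist if `P ≠ UP` -/

theorem honest_of_witness {f : Str → Str → Option Str} {V : Str → Str → Bool} {p : Polynomial ℕ}
    (hp : ∀ x w, V x w = true → w.length ≤ p.eval x.length)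
    (hf : ∀ a b z, f a b = some z → orderedFn V a b = some z ∨ orderedFn V b a = some z) :
    Honest f := by
  -- The arguments `10x` and `11w` have total length `x.length + w.length + 4`, and `0x` is longer
  -- than `x`.
  refine ⟨Polynomial.X + p + 4, fun z ⟨a, b, h⟩ => ⟨a, b, h, ?_⟩⟩
  have key : ∀ a b, orderedFn V a b = some z →
      a.length + b.length ≤ (Polynomial.X + p + 4).eval z.length := by
    intro a b h
    obtain ⟨x, w, rfl, rfl, hw, rfl⟩ := orderedFn_eq_some.1 h
    have h1 := (hp x w hw).trans (eval_mono p (Nat.le_add_right _ 1))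
    simp only [List.length_cons, Polynomial.eval_add, Polynomial.eval_X, Polynomial.eval_ofNat]
    omega
  rcases hf a b z h with h | h
  · exact key a b h
  · rw [add_comm]; exact key b a h

/-- The languages in `UP`, in terms of unique witnesses. -/
theorem exists_witness_of_mem_UP {L : Language Bool} (h : L ∈ UP) :
    ∃ (V : Str → Str → Bool) (p : Polynomial ℕ), PF (fun v : Fin 2 → Str => [V (v 0) (v 1)]) ∧
      (∀ x, x ∈ L ↔ ∃ w, V x w = true) ∧ (∀ x w, V x w = true → w.length ≤ p.eval x.length) ∧
      ∀ x w w', V x w = true → V x w' = true → w = w' := by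
  obtain ⟨N, p, hp, hu, hL⟩ := h
  obtain ⟨V, hVN, hV⟩ := N.exists_pf_isAcceptingPath
  refine ⟨V, p, hV, fun x => by simp only [hL, hVN], fun x w hw => ?_, fun x w w' hw hw' => ?_⟩
  · obtain ⟨c, hc, -⟩ := (hVN x w).1 hw
    exact hp x w ⟨c, hc⟩
  · exact hu x w w' ((hVN x w).1 hw) ((hVN x w').1 hw')

theorem exists_mem_UP_notMem_P (h : P ≠ UP) : ∃ L ∈ UP, L ∉ P := by
  by_contra! h'
  exact h (P_subset_UP.antisymm h')

theorem exists_injective_isAOWF (h : P ≠ UP) :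
    ∃ f : Str → Str → Option Str, Injective f ∧ IsAOWF f := by
  obtain ⟨L, hL, hLP⟩ := exists_mem_UP_notMem_P h
  obtain ⟨V, p, hV, hVL, hp, hu⟩ := exists_witness_of_mem_UP hL
  refine ⟨orderedFn V, fun a b c d z h h' => ?_, associative_orderedFn,
    honest_of_witness hp fun a b z => .inl, polyTimeComputable_orderedFn hV,
    fun h => hLP (mem_P_of_fpInvertible_orderedFn hV hVL h)⟩
  obtain ⟨x, w, rfl, rfl, hw, rfl⟩ := orderedFn_eq_some.1 h
  obtain ⟨x', w', rfl, rfl, hw', hx⟩ := orderedFn_eq_some.1 h'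
  obtain rfl : x = x' := by simpa using hx
  rw [hu x w w' hw hw']

theorem exists_strong_isAOWF (h : P ≠ UP) : ∃ f : Str → Str → Option Str,
    Strong f ∧ Commutative f ∧ UnorderedInjective f ∧ IsAOWF f := by
  obtain ⟨L, hL, hLP⟩ := exists_mem_UP_notMem_P h
  obtain ⟨V, p, hV, hVL, hp, hu⟩ := exists_witness_of_mem_UP hL
  refine ⟨unorderedFn V, strong_unorderedFn hV hVL hLP, unorderedFn_comm, ?_,
    associative_unorderedFn, honest_of_witness hp fun a b z => unorderedFn_eq_some.1,
    polyTimeComputable_unorderedFn hV, fun h => hLP (mem_P_of_fpInvertible_unorderedFn hV hVL h)⟩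
  have key : ∀ a b x, orderedFn V a b = some (false :: x) → ∀ w, V x w = true →
      ({a, b} : Set Str) = {true :: false :: x, true :: true :: w} := by
    intro a b x h w hw
    obtain ⟨x', w', rfl, rfl, hw', hx⟩ := orderedFn_eq_some.1 h
    obtain rfl : x = x' := by simpa using hx
    rw [hu x w w' hw hw']
  have key' : ∀ a b x, unorderedFn V a b = some (false :: x) → ∀ w, V x w = true →
      ({a, b} : Set Str) = {true :: false :: x, true :: true :: w} := by
    intro a b x h w hw
    rcases unorderedFn_eq_some.1 h with h | h
    · exact key a b x h w hw
    · rw [Set.pair_comm]; exact key b a x h w hw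
  intro a b c d z h h'
  have hz : ∃ x w, V x w = true ∧ z = false :: x := by
    rcases unorderedFn_eq_some.1 h with h | h <;>
    · obtain ⟨x, w, -, -, hw, rfl⟩ := orderedFn_eq_some.1 h
      exact ⟨x, w, hw, rfl⟩
  obtain ⟨x, w, hw, rfl⟩ := hz
  rw [key' a b x h w hw, key' c d x h' w hw]

/-! ### Polynomial-time operations on strings -/

section folds

variable {κ : Type} [Fintype κ]

/-- If each step adds at most `C` letters, the growth is linear, and the size condition for folds is
satisfied. -/
theorem total_foldl_le {R : Bool → (κ → Str) → κ → Str} {C : ℕ}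
    (h : ∀ b s, total (R b s) ≤ total s + C) (l : Str) (s : κ → Str) :
    total (l.foldl (fun s b => R b s) s) ≤ (((C + 1 : ℕ) : Polynomial ℕ) * Polynomial.X).eval
      (l.length + total s) := by
  have key : total (l.foldl (fun s b => R b s) s) ≤ total s + C * l.length := by
    induction l generalizing s with
    | nil => simp
    | cons b l ih =>
      refine (ih (R b s)).trans ?_
      have := h b s
      rw [List.length_cons, Nat.mul_succ]
      omega
  simp only [Polynomial.eval_mul, Polynomial.eval_X, Polynomial.eval_natCast, Nat.cast_id]
  nlinarith [Nat.zero_le (C * total s), l.length.zero_le]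

variable [DecidableEq κ] {ι : Type} [Fintype ι] [DecidableEq ι]

theorem PF.foldl_of_le {R : Bool → (κ → Str) → κ → Str} (hR : ∀ b k, PF fun s => R b s k) (C : ℕ)
    (h : ∀ b s, total (R b s) ≤ total s + C)
    {l : (ι → Str) → Str} (hl : PF l) {s : (ι → Str) → κ → Str} (hs : ∀ k, PF fun S => s S k)
    (k : κ) : PF fun S => (l S).foldl (fun s b => R b s) (s S) k :=
  PF.foldl hR (total_foldl_le h) hl hs k

theorem PF.foldl_cons {h : Bool → Str → Str} (hh : ∀ b, PF fun v : Fin 1 → Str => h b (v 0)) (C : ℕ)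
    (hC : ∀ b x, (h b x).length ≤ x.length + C) {l f : (ι → Str) → Str} (hl : PF l) (hf : PF f) :
    PF fun S => (l S).foldl (fun x b => h b x) (f S) := by
  refine (PF.foldl_of_le (κ := Fin 1) (R := fun b s _ => h b (s 0)) (fun b _ => hh b) C
    (fun b s => ?_) hl (s := fun S _ => f S) (fun _ => hf) 0).congr fun S => ?_
  · simpa [total] using hC b (s 0)
  · generalize f S = x
    induction l S generalizing x with
    | nil => rfl
    | cons b l ih => exact ih _

theorem PF.append {f g : (ι → Str) → Str} (hf : PF f) (hg : PF g) : PF fun S => f S ++ g S :=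
  (PF.foldl_cons (h := fun b x => b :: x) (fun b => (PF.proj 0).cons b) 1 (by simp) hf.reverse
    hg).congr fun S => by simp

theorem PF.exists_length_mul {f g : (ι → Str) → Str} (hf : PF f) (hg : PF g) :
    ∃ h : (ι → Str) → Str, PF h ∧ ∀ S, (h S).length = (f S).length * (g S).length := by
  have key : ∀ (l : Str) (s : Fin 2 → Str),
      l.foldl (fun s _ => ![s 1 ++ s 0, s 1]) s = ![l.foldl (fun a _ => s 1 ++ a) (s 0), s 1] ∧
      (l.foldl (fun a _ => s 1 ++ a) (s 0)).length = l.length * (s 1).length + (s 0).length := by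
    intro l
    induction l with
    | nil =>
      intro s
      refine ⟨?_, by simp⟩
      funext i; fin_cases i <;> rfl
    | cons b l ih =>
      intro s
      have := ih ![s 1 ++ s 0, s 1]
      simp only [List.foldl_cons, this.1]
      refine ⟨rfl, ?_⟩
      have h2 := this.2
      simp only [Matrix.cons_val_zero, Matrix.cons_val_one, List.length_append] at h2
      rw [h2, List.length_cons]
      ring
  -- The second string is prepended to an accumulator once for each letter of the first. The final
  -- size is at most the product of two lengths plus the initial size, whence the bound `X + X ^ 2`.
  refine ⟨fun S => (f S).foldl (fun s _ => ![s 1 ++ s 0, s 1]) ![[], g S] 0,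
    PF.foldl (R := fun _ s => ![s 1 ++ s 0, s 1]) (fun b k => ?_)
      (q := Polynomial.X + Polynomial.X ^ 2) (fun l s => ?_) hf (fun k => ?_) 0, fun S => ?_⟩
  · fin_cases k
    exacts [(PF.proj 1).append (PF.proj 0), PF.proj 1]
  · rw [(key l s).1]
    simp only [total, Fin.sum_univ_two, Matrix.cons_val_zero, Matrix.cons_val_one, (key l s).2,
      Polynomial.eval_add, Polynomial.eval_X, Polynomial.eval_pow]
    nlinarith [Nat.zero_le l.length, Nat.zero_le (s 0).length, Nat.zero_le (s 1).length,
      Nat.zero_le (l.length * (s 0).length), Nat.zero_le (l.length * (s 1).length)]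
  · fin_cases k
    exacts [PF.nil, hg]
  · have := key (f S) ![[], g S]
    simp [this.1]

/-- Such a string serves as a clock and as padding: loops over its letters run for at least a
prescribed polynomial number of rounds. -/
theorem PF.exists_length_ge (q : Polynomial ℕ) {f : (ι → Str) → Str} (hf : PF f) :
    ∃ h : (ι → Str) → Str, PF h ∧ ∀ S, q.eval (f S).length ≤ (h S).length := by
  induction q using Polynomial.induction_on' with
  | add p q hp hq =>
    obtain ⟨g, hg, hgl⟩ := hp
    obtain ⟨h, hh, hhl⟩ := hq
    refine ⟨_, hg.append hh, fun S => ?_⟩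
    rw [Polynomial.eval_add, List.length_append]
    exact add_le_add (hgl S) (hhl S)
  | monomial n a =>
    induction n with
    | zero => exact ⟨_, PF.const (List.replicate a true), fun S => by simp⟩
    | succ n ih =>
      obtain ⟨g, hg, hgl⟩ := ih
      obtain ⟨h, hh, hhl⟩ := hg.exists_length_mul hf
      refine ⟨h, hh, fun S => ?_⟩
      rw [hhl]
      have := Nat.mul_le_mul_right (f S).length (hgl S)
      simpa [pow_succ, mul_assoc] using this

end folds

/-! ### Comparing strings -/

/-- The lexicographic order. -/
def lexLE : Str → Str → Bool
  | [], _ => true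
  | _ :: _, [] => false
  | a :: x, b :: y => if a = b then lexLE x y else b

theorem lexLE_total (x y : Str) : lexLE x y = true ∨ lexLE y x = true := by
  induction x generalizing y with
  | nil => simp [lexLE]
  | cons a x ih =>
    cases y with
    | nil => simp [lexLE]
    | cons b y => cases a <;> cases b <;> simp [lexLE, ih]

theorem lexLE_antisymm {x y : Str} (h : lexLE x y = true) (h' : lexLE y x = true) : x = y := by
  induction x generalizing y with
  | nil => cases y <;> simp_all [lexLE]
  | cons a x ih =>
    cases y with
    | nil => simp [lexLE] at h
    | cons b y => cases a <;> cases b <;> simp [lexLE] at h h' ⊢ <;> exact ih h h'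

theorem lexLE_self (x : Str) : lexLE x x = true := by
  simpa using lexLE_total x x

/-- One step of a comparison: the state consists of the rest of the second string, and of the
result once this is known. -/
def lexStep (a : Bool) (s : Fin 2 → Str) : Fin 2 → Str :=
  ![(s 0).tail, if (s 1).head? == none then
      (if (s 0).head? == none then [false] else if (s 0).head? == some a then [] else [!a])
    else s 1]

theorem lexStep_decided (a b : Bool) (y : Str) : lexStep a ![y, [b]] = ![y.tail, [b]] := by
  simp [lexStep]

theorem lexStep_nil (a : Bool) : lexStep a ![[], []] = ![[], [false]] := by
  simp [lexStep]

theorem lexStep_cons (a b : Bool) (y : Str) :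
    lexStep a ![b :: y, []] = ![y, if a = b then [] else [b]] := by
  cases a <;> cases b <;> simp [lexStep]

/-- As long as the letters agree, the result is empty; the first difference, or the end of `y`
before that of `x`, fixes it. If nothing has been fixed at the end, then `x` is a prefix of `y`,
hence the test for `some false`. -/
theorem foldl_lexStep (x y : Str) :
    (x.foldl (fun s b => lexStep b s) ![y, []] 1).head? = some false ↔ lexLE x y = false := by
  have dec : ∀ (x y : Str) (b : Bool), x.foldl (fun s b => lexStep b s) ![y, [b]] 1 = [b] := by
    intro x
    induction x with
    | nil => intros; rfl
    | cons a x ih => intro y b; rw [List.foldl_cons, lexStep_decided, ih]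
  induction x generalizing y with
  | nil => simp [lexLE]
  | cons a x ih =>
    rw [List.foldl_cons]
    rcases y with _ | ⟨b, y⟩
    · rw [lexStep_nil, dec]; simp [lexLE]
    · rw [lexStep_cons, lexLE]
      split_ifs with h
      · exact ih y
      · rw [dec]; simp

section

variable {ι : Type} [Fintype ι] [DecidableEq ι] {f g : (ι → Str) → Str}

theorem PF.lexLE (hf : PF f) (hg : PF g) : PF fun S => [lexLE (f S) (g S)] := by
  refine ((PF.foldl_of_le (R := lexStep) (fun a k => ?_) 1 (fun a s => ?_) hf
    (s := fun S => ![g S, []]) (fun k => ?_) 1).head?_eq (some false)).not.congr fun S => ?_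
  · fin_cases k
    · exact (PF.proj 0).tail
    · exact ((PF.proj 1).head?_eq none).ite (((PF.proj 0).head?_eq none).ite (PF.const _)
        (((PF.proj 0).head?_eq (some a)).ite PF.nil (PF.const _))) (PF.proj 1)
  · unfold lexStep total
    simp only [Fin.sum_univ_two, Matrix.cons_val_zero, Matrix.cons_val_one,
      List.length_tail]
    split_ifs <;> (try simp only [List.length_cons, List.length_nil]) <;> omega
  · fin_cases k
    exacts [hg, PF.nil]
  · congr 1
    rw [Bool.eq_iff_iff, Bool.not_eq_true', beq_eq_false_iff_ne, Ne, ← Bool.not_eq_false, not_iff_not]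
    exact foldl_lexStep (f S) (g S)

theorem PF.beq (hf : PF f) (hg : PF g) : PF fun S => [f S == g S] := by
  refine ((hf.lexLE hg).and (hg.lexLE hf)).congr fun S => ?_
  congr 1
  rw [Bool.eq_iff_iff, Bool.and_eq_true, beq_iff_eq]
  exact ⟨fun h => lexLE_antisymm h.1 h.2, fun h => by rw [h]; simp [lexLE_self]⟩

end

/-! ### Encoding pairs -/

/-- An encoding of pairs. -/
def pairStr (a b : Str) : Str := a.foldl (fun x c => true :: c :: x) (false :: b)

/-- The encoding of pairs, with padding. -/
def encode (k a b : Str) : Str := k.foldl (fun x _ => false :: x) (true :: pairStr a b)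

/-- One step of the decoding of a pair. -/
def unpairStep (s : Fin 2 → Str) : Fin 2 → Str :=
  if ((s 0).head? == some true && !((s 0).tail.head? == none)) = true then
    ![(s 0).tail.tail, (if (s 0).tail.head? == some true then true :: s 1 else false :: s 1)]
  else s

/-- The rest after decoding the first component of a pair, and this component. -/
def unpair (v : Str) : Fin 2 → Str := v.foldl (fun s _ => unpairStep s) ![v, []]

/-- Remove the padding. -/
def unpad (u : Str) : Str := (u.foldl
  (fun u _ => if u.head? == some false then u.tail else u) u).tail

/-- The first component of a pair, given by its padded encoding. -/
def decodeFst (u : Str) : Str := unpair (unpad u) 1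

/-- The second component of a pair, given by its padded encoding. -/
def decodeSnd (u : Str) : Str := (unpair (unpad u) 0).tail

/-- Whether a string is the padded encoding of a pair. -/
def isCode (u : Str) : Bool := (unpair (unpad u) 0).head? == some false

/-- The code is self-delimiting: each letter of `a`, the last one first, is preceded by `1`, and a
`0` separates these from `b`. Prepending the decoded letters restores their order. -/
theorem pairStr_concat (a b : Str) (c : Bool) :
    pairStr (a ++ [c]) b = true :: c :: pairStr a b := by
  simp [pairStr]

theorem length_pairStr (a b : Str) : (pairStr a b).length = 2 * a.length + b.length + 1 := by
  induction a using List.reverseRecOn with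
  | nil => simp [pairStr]
  | append_singleton a c ih => rw [pairStr_concat]; simp [ih]; ring

theorem encode_eq (k a b : Str) :
    encode k a b = List.replicate k.length false ++ true :: pairStr a b := by
  unfold encode
  generalize true :: pairStr a b = x
  induction k generalizing x with
  | nil => rfl
  | cons c k ih => rw [List.foldl_cons, ih]; simp [List.replicate_succ', List.append_assoc]

theorem unpairStep_eq (v a : Str) : unpairStep ![v, a] = match v with
    | true :: c :: v' => ![v', c :: a]
    | _ => ![v, a] := by
  rcases v with _ | ⟨_ | _, _ | ⟨_ | _, v⟩⟩ <;> simp [unpairStep]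

/-- The result of decoding a pair, as a recursive function. -/
def unpairAux : Str → Str → Fin 2 → Str
  | true :: c :: v, a => unpairAux v (c :: a)
  | v, a => ![v, a]

/-- A state from which nothing more can be decoded is fixed, so surplus rounds of the loop do no
harm. -/
theorem iterate_unpairStep (n : ℕ) (v a : Str) (hn : v.length ≤ n) :
    unpairStep^[n] ![v, a] = unpairAux v a := by
  induction n generalizing v a with
  | zero =>
    obtain rfl : v = [] := by simpa using hn
    rfl
  | succ n ih =>
    have fix : unpairStep ![v, a] = ![v, a] → unpairStep^[n + 1] ![v, a] = ![v, a] :=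
      fun h => iterate_fixed h _
    rcases v with _ | ⟨_ | _, _ | ⟨c, v⟩⟩
    · exact fix (unpairStep_eq _ _)
    · exact fix (unpairStep_eq _ _)
    · exact fix (unpairStep_eq _ _)
    · exact fix (unpairStep_eq _ _)
    · rw [iterate_succ_apply, unpairStep_eq]
      simp only [List.length_cons] at hn
      exact ih _ _ (by omega)

theorem unpair_eq (v : Str) : unpair v = unpairAux v [] := by
  rw [unpair, List.foldl_const, iterate_unpairStep _ _ _ le_rfl]

theorem unpairAux_pairStr (a b c : Str) :
    unpairAux (pairStr a b) c = ![false :: b, a ++ c] := by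
  induction a using List.reverseRecOn generalizing c with
  | nil => rfl
  | append_singleton a d ih => rw [pairStr_concat, unpairAux, ih]; simp

theorem eq_pairStr_of_unpairAux {v c b : Str} (h : unpairAux v c 0 = false :: b) :
    ∃ a, v = pairStr a b ∧ unpairAux v c 1 = a ++ c := by
  induction v, c using unpairAux.induct with
  | case1 c d v ih =>
    rw [unpairAux] at h ⊢
    obtain ⟨a, rfl, ha⟩ := ih h
    exact ⟨a ++ [c], (pairStr_concat a b c).symm, by simpa using ha⟩
  | case2 v c hv =>
    rw [unpairAux] at h ⊢
    · exact ⟨[], h, rfl⟩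
    · exact hv
    · exact hv

theorem unpad_eq (u : Str) : unpad u = (u.dropWhile (!·)).tail := by
  have key : ∀ (n : ℕ) (u : Str), u.length ≤ n →
      (fun u : Str => if u.head? == some false then u.tail else u)^[n] u = u.dropWhile (!·) := by
    intro n
    induction n with
    | zero => intro u hu; obtain rfl : u = [] := by simpa using hu
              rfl
    | succ n ih =>
      intro u hu
      rw [iterate_succ_apply]
      rcases u with _ | ⟨_ | _, u⟩
      · exact ih [] (by simp)
      · exact ih u (by simpa using hu)
      · exact iterate_fixed rfl _
  rw [unpad, List.foldl_const, key _ _ le_rfl]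

theorem unpad_replicate (k : ℕ) (v : Str) : unpad (List.replicate k false ++ true :: v) = v := by
  rw [unpad_eq]
  induction k with
  | zero => rfl
  | succ k ih => simp [List.replicate_succ]

theorem decode_replicate (k : ℕ) (a b : Str) :
    isCode (List.replicate k false ++ true :: pairStr a b) = true ∧
    decodeFst (List.replicate k false ++ true :: pairStr a b) = a ∧
    decodeSnd (List.replicate k false ++ true :: pairStr a b) = b := by
  simp [isCode, decodeFst, decodeSnd, unpad_replicate, unpair_eq, unpairAux_pairStr]

theorem eq_of_isCode {u : Str} (h : isCode u = true) :
    ∃ k, u = List.replicate k false ++ true :: pairStr (decodeFst u) (decodeSnd u) := by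
  rw [isCode, beq_iff_eq, List.head?_eq_some_iff] at h
  obtain ⟨b, hb⟩ := h
  have hb' : decodeSnd u = b := by rw [decodeSnd, hb]; rfl
  rw [unpair_eq] at hb
  obtain ⟨a, hv, ha⟩ := eq_pairStr_of_unpairAux hb
  have ha' : decodeFst u = a := by rw [decodeFst, unpair_eq, ha, List.append_nil]
  rw [ha', hb', ← hv, unpad_eq]
  clear ha ha' hb hb'
  have hne : (u.dropWhile (!·)).tail ≠ [] := by
    rw [← unpad_eq, hv]
    intro h
    have := congrArg List.length h
    simp [length_pairStr] at this
  clear hv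
  induction u with
  | nil => simp at hne
  | cons c u ih =>
    cases c with
    | true => exact ⟨0, rfl⟩
    | false =>
      obtain ⟨k, hk⟩ := ih hne
      refine ⟨k + 1, ?_⟩
      rw [List.replicate_succ, List.cons_append]
      exact congrArg _ hk

/-- A code consists of padding and the encoded pair, so the length determines the padding. This
makes witnesses of a prescribed length unique. -/
theorem eq_of_decode_eq {u u' : Str} (h : isCode u = true) (h' : isCode u' = true)
    (hl : u.length = u'.length) (h₁ : decodeFst u = decodeFst u')
    (h₂ : decodeSnd u = decodeSnd u') : u = u' := by
  obtain ⟨k, hk⟩ := eq_of_isCode h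
  obtain ⟨k', hk'⟩ := eq_of_isCode h'
  rw [h₁, h₂] at hk
  have : k = k' := by
    have e := congrArg List.length hk
    have e' := congrArg List.length hk'
    simp only [List.length_append, List.length_replicate] at e e'
    omega
  exact hk.trans ((congrArg (List.replicate · false ++ _) this).trans hk'.symm)

section

variable {ι : Type} [Fintype ι] [DecidableEq ι] {f g h : (ι → Str) → Str}

theorem PF.encode (hf : PF f) (hg : PF g) (hh : PF h) :
    PF fun S => encode (f S) (g S) (h S) :=
  PF.foldl_cons (h := fun _ x => false :: x) (fun _ => (PF.proj 0).cons false) 1 (by simp) hf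
    ((PF.foldl_cons (h := fun c x => true :: c :: x) (fun c => ((PF.proj 0).cons c).cons true) 2
      (by simp) hg (hh.cons false)).cons true)

theorem PF.unpad (hf : PF f) : PF fun S => unpad (f S) :=
  (PF.foldl_cons (h := fun _ u => if u.head? == some false then u.tail else u)
    (fun _ => ((PF.proj 0).head?_eq _).ite (PF.proj 0).tail (PF.proj 0)) 0
    (fun _ x => by split_ifs <;> simp) hf hf).tail

theorem PF.unpair (hf : PF f) (k : Fin 2) : PF fun S => unpair (f S) k := by
  refine PF.foldl_of_le (R := fun _ => unpairStep) (fun _ k => ?_) 0 (fun _ s => ?_) hf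
    (s := fun S => ![f S, []]) (fun k => ?_) k
  · have hc : PF fun s : Fin 2 → Str => [(s 0).head? == some true && !((s 0).tail.head? == none)] :=
      ((PF.proj 0).head?_eq _).and ((PF.proj 0).tail.head?_eq _).not
    have hv : PF fun s : Fin 2 → Str =>
        if (s 0).tail.head? == some true then true :: s 1 else false :: s 1 :=
      ((PF.proj 0).tail.head?_eq _).ite ((PF.proj 1).cons true) ((PF.proj 1).cons false)
    fin_cases k
    · refine (hc.ite (PF.proj 0).tail.tail (PF.proj 0)).congr fun s => ?_
      rw [unpairStep]; split_ifs <;> rfl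
    · refine (hc.ite hv (PF.proj 1)).congr fun s => ?_
      rw [unpairStep]; split_ifs <;> rfl
  · rw [show s = ![s 0, s 1] by funext i; fin_cases i <;> rfl, unpairStep_eq]
    generalize s 0 = v
    rcases v with _ | ⟨_ | _, _ | ⟨c, v⟩⟩ <;> simp [total, Fin.sum_univ_two]
    omega
  · fin_cases k
    exacts [hf, PF.nil]

theorem PF.decodeFst (hf : PF f) : PF fun S => decodeFst (f S) := hf.unpad.unpair 1

theorem PF.decodeSnd (hf : PF f) : PF fun S => decodeSnd (f S) := (hf.unpad.unpair 0).tail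

theorem PF.isCode (hf : PF f) : PF fun S => [isCode (f S)] := (hf.unpad.unpair 0).head?_eq _

/-- The letter of `u` at the position given by the length of `c`, counted from the end. -/
def letterAt (c u : Str) : Bool := c.foldl (fun x _ => x.tail) u.reverse |>.headD false

theorem letterAt_eq (c u : Str) : letterAt c u = u.reverse.getD c.length false := by
  have : ∀ x : Str, c.foldl (fun x _ => x.tail) x = x.drop c.length := by
    induction c with
    | nil => simp
    | cons d c ih => intro x; rw [List.foldl_cons, ih]; simp [List.drop_tail]
  rw [letterAt, this]
  simp [List.headD_eq_head?_getD, List.getD_eq_getElem?_getD]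

theorem PF.letterAt (hf : PF f) (hg : PF g) : PF fun S => [letterAt (f S) (g S)] :=
  ((PF.foldl_cons (h := fun _ x => x.tail) (fun _ => (PF.proj 0).tail) 0 (by simp) hf
    hg.reverse).head?_eq (some true)).congr fun S => by
      rw [OneWay.letterAt]
      generalize (f S).foldl (fun x _ => x.tail) (g S).reverse = x
      rcases x with _ | ⟨_ | _, _⟩ <;> rfl

end

/-! ### Inverting functions with unique preimages, if P = UP -/

theorem PolyTimeComputable.pf_eq {f : Str → Str → Option Str} (hf : PolyTimeComputable f)
    {ι : Type} [Fintype ι] [DecidableEq ι] {a b z : (ι → Str) → Str} (ha : PF a) (hb : PF b)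
    (hz : PF z) : PF fun S => [f (a S) (b S) == some (z S)] := by
  have h1 := (FP.isSome hf).congr (g := fun v => [(f (v 0) (v 1)).isSome]) fun v => by simp
  have h2 := (FP.value hf 0).congr (g := fun v => (f (v 0) (v 1)).getD []) fun v => by
    cases h : f (v 0) (v 1) <;> simp
  have h1' := PF.comp₂ (h := fun a b => [(f a b).isSome]) h1 ha hb
  have h2' := PF.comp₂ (h := fun a b => (f a b).getD []) h2 ha hb
  refine (h1'.and (h2'.beq hz)).congr fun S => ?_
  cases h : f (a S) (b S) <;> simp

/-- The test whether `u` encodes a preimage of `z` under `f`.  If both `(a, b)` and `(b, a)` are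
preimages, only one of them is accepted. -/
def encodesPreimage (f : Str → Str → Option Str) (z u : Str) : Bool :=
  isCode u && (f (decodeFst u) (decodeSnd u) == some z &&
    (lexLE (decodeFst u) (decodeSnd u) || !(f (decodeSnd u) (decodeFst u) == some z)))

/-- The test whether `u` encodes a preimage as above, and a certain letter of `u` is `true`; the
instance `x` encodes the position of the letter and the element of the range. -/
def letterTest (f : Str → Str → Option Str) (x u : Str) : Bool :=
  encodesPreimage f (decodeSnd x) u && letterAt (decodeFst x) u

section inversion

variable {f : Str → Str → Option Str}

/-- Both codes describe the same unordered pair. If the orders are opposite, then both ordered pairs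
are preimages, and the tie-break requires `≤` in both directions, so the components coincide. -/
theorem eq_of_encodesPreimage (hf : UnorderedInjective f) {z u u' : Str}
    (h : encodesPreimage f z u = true) (h' : encodesPreimage f z u' = true)
    (hl : u.length = u'.length) : u = u' := by
  simp only [encodesPreimage, Bool.and_eq_true, beq_iff_eq, Bool.or_eq_true, Bool.not_eq_true',
    beq_eq_false_iff_ne] at h h'
  obtain ⟨hc, hz, ho⟩ := h
  obtain ⟨hc', hz', ho'⟩ := h'
  have key : decodeFst u = decodeFst u' ∧ decodeSnd u = decodeSnd u' := by
    rcases Set.pair_eq_pair_iff.1 (hf _ _ _ _ _ hz hz') with h | ⟨h1, h2⟩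
    · exact h
    · rw [← h1, ← h2] at hz' ho'
      have e := lexLE_antisymm (ho.resolve_right (not_not.2 hz')) (ho'.resolve_right (not_not.2 hz))
      exact ⟨e.trans h2, e.symm.trans h1⟩
  exact eq_of_decode_eq hc hc' hl key.1 key.2

/-- If the given order fails the tie-break, the opposite order is also a preimage and passes it. The
padding is arbitrary, so an acceptable code exists in every sufficient length. -/
theorem exists_encodesPreimage {z a b : Str} (h : f a b = some z) :
    ∃ a' b', a'.length + b'.length = a.length + b.length ∧ ∀ k,
      encodesPreimage f z (List.replicate k false ++ true :: pairStr a' b') = true := by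
  have key : ∀ a b, f a b = some z → (lexLE a b = true ∨ f b a ≠ some z) → ∀ k,
      encodesPreimage f z (List.replicate k false ++ true :: pairStr a b) = true := by
    intro a b h ho k
    simp only [encodesPreimage, decode_replicate, Bool.true_and, Bool.and_eq_true, beq_iff_eq,
      Bool.or_eq_true, Bool.not_eq_true', beq_eq_false_iff_ne]
    exact ⟨h, ho⟩
  by_cases ho : lexLE a b = true ∨ f b a ≠ some z
  · exact ⟨a, b, rfl, key a b h ho⟩
  · push Not at ho
    exact ⟨b, a, add_comm _ _, key b a ho.2 (.inl ((lexLE_total a b).resolve_left ho.1))⟩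

theorem pf_letterTest (hf : PolyTimeComputable f) :
    PF fun v : Fin 2 → Str => [letterTest f (v 0) (v 1)] := by
  have hx := PF.proj (ι := Fin 2) 0
  have hu := PF.proj (ι := Fin 2) 1
  exact (hu.isCode.and ((hf.pf_eq hu.decodeFst hu.decodeSnd hx.decodeSnd).and
    ((hu.decodeFst.lexLE hu.decodeSnd).or
      (hf.pf_eq hu.decodeSnd hu.decodeFst hx.decodeSnd).not))).and (hx.decodeFst.letterAt hu)

/-- One step of the search: the state consists of the final segment of the witness that has been
found, of a counter, of the element of the range, and of the padding. -/
def searchStep (D : Str → Bool) (s : Fin 4 → Str) : Fin 4 → Str :=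
  ![(if D (encode (s 3) (s 1) (s 2)) = true then true :: s 0 else false :: s 0),
    true :: s 1, s 2, s 3]

/-- The search for a witness. -/
def search (D : Str → Bool) (m z : Str) : Str :=
  m.foldl (fun s _ => searchStep D s) ![[], [], z, m] 0

theorem PF.search {ι : Type} [Fintype ι] [DecidableEq ι] {D : Str → Bool}
    (hD : PF fun v : Fin 1 → Str => [D (v 0)]) {m z : (ι → Str) → Str} (hm : PF m) (hz : PF z) :
    PF fun S => search D (m S) (z S) := by
  refine PF.foldl_of_le (R := fun _ => searchStep D) (fun _ k => ?_) 2 (fun _ s => ?_) hm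
    (s := fun S => ![[], [], z S, m S]) (fun k => ?_) 0
  · fin_cases k
    · exact (PF.comp₁ (h := fun x => [D x]) hD ((PF.proj 3).encode (PF.proj 1) (PF.proj 2))).ite
        ((PF.proj 0).cons true) ((PF.proj 0).cons false)
    · exact (PF.proj 1).cons true
    · exact PF.proj 2
    · exact PF.proj 3
  · simp only [total, Fin.sum_univ_four]
    have h0 : (searchStep D s 0).length = (s 0).length + 1 := by
      simp only [searchStep, Matrix.cons_val_zero]
      split_ifs <;> rfl
    have h1 : (searchStep D s 1).length = (s 1).length + 1 := rfl
    have h2 : searchStep D s 2 = s 2 := rfl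
    have h3 : searchStep D s 3 = s 3 := rfl
    rw [h0, h1, h2, h3]
    omega
  · fin_cases k
    exacts [PF.nil, PF.nil, hz, hm]

/-- The queries ask for the letters in turn and do not depend on earlier answers. Each answer is
prepended, which reverses the string. -/
theorem search_eq {D : Str → Bool} {m z U : Str} (hU : U.length = m.length)
    (hD : ∀ i, D (encode m (List.replicate i true) z) = U.getD i false) :
    search D m z = U.reverse := by
  have step : ∀ i (acc : Str), searchStep D ![acc, List.replicate i true, z, m] =
      ![U.getD i false :: acc, List.replicate (i + 1) true, z, m] := by
    intro i acc
    funext j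
    fin_cases j
    · change (if D (encode m (List.replicate i true) z) = true then _ else _) = _
      rw [hD]
      cases U.getD i false <;> rfl
    · rfl
    · rfl
    · rfl
  have key : ∀ i ≤ U.length, (searchStep D)^[i] ![[], [], z, m] =
      ![(U.take i).reverse, List.replicate i true, z, m] := by
    intro i
    induction i with
    | zero => intro _; rfl
    | succ i ih =>
      intro hi
      rw [iterate_succ_apply', ih (by omega), step, List.take_add_one, List.reverse_append,
        List.getElem?_eq_getElem (by omega), List.getD_eq_getElem _ _ (by omega)]
      rfl
  rw [search, List.foldl_const, ← hU, key _ le_rfl]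
  simp

theorem fpInvertible_of_P_eq_UP (hPU : P = UP) (hi : UnorderedInjective f) (hh : Honest f)
    (hf : PolyTimeComputable f) : FPInvertible f := by
  obtain ⟨p, hp⟩ := hh
  have hUP := mem_UP_of_unique (pf_letterTest hf) fun x u u' hu hu' h h' => by
    simp only [letterTest, Bool.and_eq_true] at h h'
    exact eq_of_encodesPreimage hi h.1 h'.1 (hu.trans hu'.symm)
  rw [← hPU] at hUP
  classical
  set D : Str → Bool := fun x => decide (∃ u, u.length = x.length ∧ letterTest f x u = true) with hDdef
  have hD : PF fun v : Fin 1 → Str => [D (v 0)] :=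
    (mem_P_iff fun x => by simp only [hDdef, decide_eq_true_eq]; rfl).1 hUP
  -- The code `1` followed by `pairStr a b` has length `2 * a.length + b.length + 2`, which is at
  -- most `2 * p + 2` if `p` bounds the size of the preimage.
  obtain ⟨m, hm, hml⟩ := PF.exists_length_ge (2 * p + 2) (PF.proj (ι := Fin 1) 0)
  have hs := PF.search hD hm (PF.proj 0)
  refine ⟨fun z => (decodeFst (search D (m fun _ => z) z), decodeSnd (search D (m fun _ => z) z)),
    ?_, fun z hz => ?_⟩
  · have h := FP.of_pf (n := 2) (b := fun _ => true) (PF.const _)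
      (v := ![fun v => decodeFst (search D (m v) (v 0)), fun v => decodeSnd (search D (m v) (v 0))])
      fun j => by fin_cases j; exacts [hs.decodeFst, hs.decodeSnd]
    convert h using 1
    funext v
    have e : (fun _ => v 0) = v := by funext i; fin_cases i; rfl
    simp only [e, if_true, Option.some.injEq]
    funext j
    fin_cases j <;> rfl
  · obtain ⟨a, b, hab, hlen⟩ := hp z hz
    obtain ⟨a, b, hl, henc⟩ := exists_encodesPreimage hab
    have hT : (true :: pairStr a b).length ≤ (m fun _ => z).length := by
      have := hml fun _ => z
      simp only [Polynomial.eval_add, Polynomial.eval_mul, Polynomial.eval_ofNat] at this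
      simp only [List.length_cons, length_pairStr]
      omega
    set M := m fun _ => z
    have getD_pad : ∀ (l : Str) (k i : ℕ), (l ++ List.replicate k false).getD i false =
        l.getD i false := by
      intro l k i
      simp only [List.getD_eq_getElem?_getD, List.getElem?_append, List.getElem?_replicate]
      by_cases h : i < l.length
      · simp [h]
      · simp only [h, if_false]
        rw [List.getElem?_eq_none (by omega)]
        split_ifs <;> rfl
    -- The string `U` is the code read from its end, filled up with zeros. The length of an
    -- instance, and thus that of its witness, varies with the counter `i`. But padding stands in
    -- front and positions are counted from the end, so all instances refer to the same letters.
    have hsearch := search_eq (D := D) (m := M) (z := z)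
      (U := (true :: pairStr a b).reverse ++
        List.replicate (M.length - (true :: pairStr a b).length) false)
      (by simp only [List.length_append, List.length_reverse, List.length_replicate]; omega) (by
        intro i
        set x := encode M (List.replicate i true) z with hx
        rw [encode_eq] at hx
        -- The instance is itself padded with `M`, which leaves enough room for a witness of the
        -- same length as the instance.
        have hxl : (true :: pairStr a b).length ≤ x.length := by
          rw [hx, List.length_append, List.length_replicate]; omega
        have hx1 : decodeFst x = List.replicate i true := by rw [hx]; exact (decode_replicate _ _ _).2.1
        have hx2 : decodeSnd x = z := by rw [hx]; exact (decode_replicate _ _ _).2.2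
        set u := List.replicate (x.length - (true :: pairStr a b).length) false ++
          true :: pairStr a b with hu
        have hul : u.length = x.length := by
          rw [hu, List.length_append, List.length_replicate]; omega
        have hbit : letterAt (List.replicate i true) u =
            (true :: pairStr a b).reverse.getD i false := by
          rw [letterAt_eq, hu, List.reverse_append, List.reverse_replicate, getD_pad,
            List.length_replicate]
        rw [getD_pad, ← hbit, Bool.eq_iff_iff, hDdef, decide_eq_true_eq]
        simp only [letterTest, hx1, hx2, Bool.and_eq_true]
        constructor
        -- By uniqueness, any witness for this instance is the padded code `u`.
        · rintro ⟨u', hu', he, hb⟩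
          rwa [eq_of_encodesPreimage hi he (henc _) (hu'.trans hul.symm)] at hb
        · exact fun hb => ⟨u, hul, henc _, hb⟩)
    rw [List.reverse_append, List.reverse_reverse, List.reverse_replicate] at hsearch
    change f (decodeFst (search D M z)) (decodeSnd (search D M z)) = some z
    simp only [hsearch, decode_replicate]
    have := henc 0
    simp only [encodesPreimage, decode_replicate, Bool.true_and, Bool.and_eq_true,
      beq_iff_eq] at this
    exact this.1

/-! ### Comparison of the notions, and the equivalence -/

theorem UnorderedInjective.of_injective (h : Injective f) : UnorderedInjective f := by
  intro a b c d z hab hcd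
  have := h a b c d z hab hcd
  simp only [Prod.mk.injEq] at this
  rw [this.1, this.2]

theorem Associative.weaklyAssociative (h : Associative f) : WeaklyAssociative f := by
  intro x y z xy yz a b hxy hyz ha hb
  have := h x y z
  have e1 : extension f (some x) (some y) = some xy := hxy
  have e2 : extension f (some y) (some z) = some yz := hyz
  rw [e1, e2] at this
  change f xy z = f x yz at this
  rw [ha, hb] at this
  exact (Option.some.inj this).symm

theorem P_ne_UP_of_isOneWay (hi : UnorderedInjective f) (h : IsOneWay f) : P ≠ UP :=
  fun hPU => h.2.2 (fpInvertible_of_P_eq_UP hPU hi h.1 h.2.1)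

end inversion

end OneWay

theorem mainTheorem2 :
    List.TFAE [
      OneWay.P ≠ OneWay.UP,
      ∃ f : OneWay.Str → OneWay.Str → Option OneWay.Str,
        OneWay.Injective f ∧ OneWay.IsAwOWF f,
      ∃ f : OneWay.Str → OneWay.Str → Option OneWay.Str,
        OneWay.Injective f ∧ OneWay.IsAOWF f,
      ∃ f : OneWay.Str → OneWay.Str → Option OneWay.Str,
        OneWay.Strong f ∧ OneWay.Commutative f ∧ OneWay.UnorderedInjective f ∧ OneWay.IsAwOWF f,
      ∃ f : OneWay.Str → OneWay.Str → Option OneWay.Str,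
        OneWay.Strong f ∧ OneWay.Commutative f ∧ OneWay.UnorderedInjective f ∧
          OneWay.IsAOWF f] := by
  tfae_have 1 → 3 := OneWay.exists_injective_isAOWF
  tfae_have 1 → 5 := OneWay.exists_strong_isAOWF
  tfae_have 3 → 2 := fun ⟨f, hi, ha, ho⟩ => ⟨f, hi, ha.weaklyAssociative, ho⟩
  tfae_have 5 → 4 := fun ⟨f, hs, hc, hi, ha, ho⟩ => ⟨f, hs, hc, hi, ha.weaklyAssociative, ho⟩
  tfae_have 2 → 1 := fun ⟨_, hi, _, ho⟩ => OneWay.P_ne_UP_of_isOneWay (.of_injective hi) ho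
  tfae_have 4 → 1 := fun ⟨_, _, _, hi, _, ho⟩ => OneWay.P_ne_UP_of_isOneWay hi ho
  tfae_finish
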